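/- Setting. Let $\Lambda$ be a set of lattice sites with a metric $\mathrm{dist}$; the site $v$ carries the Hilbert space $\mathbb C^{d_v}$ with $d_v<\infty$, and a finite region $A\subset\Lambda$ carries $\mathcal H_A=\bigotimes_{v\in A}\mathbb C^{d_v}$. Let $O_x$ be an operator supported on a finite set of sites $S$; for $A\supseteq S$ it is identified with $O_x\otimes\mathbb 1_{A\setminus S}$ on $\mathcal H_A$, and $\|O_x\|_\infty$ is its operator norm. For a density matrix $\rho_A$ on $\mathcal H_A$, $A\supseteq S$, let $$R^{(1)}(\rho_A;O_x)=\mathrm{Tr}\big(\sqrt{\rho_A}\,O_x\sqrt{\rho_A}\,O_x^\dagger\big),\qquad F(\rho_A;O_x)=\mathrm{Tr}\sqrt{\sqrt{\rho_A}\,\big(O_x\rho_A O_x^\dagger\big)\sqrt{\rho_A}} .$$ Consider either a density matrix $\rho$ of a finite system on a finite set $\Omega\subset\Lambda$ of sites, with reduced density matrices $\rho_A=\mathrm{Tr}_{\Omega\setminus A}\,\rho$ for $A\subseteq\Omega$, or a state $\omega$ of the (possibly infinite) lattice, i.e. a normalized positive linear functional on the quasi-local $C^*$-algebra (the norm closure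 of the algebra of operators of finite support), with $\rho_A$ the unique matrix such that $\omega(O)=\mathrm{Tr}(\rho_A O)$ for all operators $O$ on the finite region $A$. Lemma. In both cases: 1. If $S\subseteq A\subseteq B$ are finite regions (contained in $\Omega$ in the finite case), then $R^{(1)}(\rho_A;O_x)\ge R^{(1)}(\rho_B;O_x)$. 2. For every finite region $A\supseteq S$ (contained in $\Omega$ in the finite case), $$F(\rho_A;O_x)^2\le R^{(1)}(\rho_A;O_x)\le\|O_x\|_\infty\,F(\rho_A;O_x).$$ Moreover, call a sequence of finite regions $A^{(1)}\subseteq A^{(2)}\subseteq\cdots$ that contain the site $x$ a covering centered at $x$ if $\mathrm{dist}(x,\Lambda\setminus A^{(n)})\to\infty$ (with $\mathrm{dist}(x,\emptyset)=\infty$). For a state $\omega$ of the lattice: 3. For every site $x$ there are real numbers $R^{(1)}(\omega;O_x)$ and $F(\omega;O_x)$ such that, for every covering $(A^{(n)})$ centered at $x$, $R^{(1)}(\rho_{A^{(n)}};O_x)\to R^{(1)}(\omega;O_x)$ and $F(\rho_{A^{(n)}};O_x)\to F(\omega;O_x)$ as $n\to\infty$ (the limits exist and do not depend on the covering); and $$F(\omega;O_x)^2\le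 R^{(1)}(\omega;O_x)\le\|O_x\|_\infty\,F(\omega;O_x),$$ in particular $R^{(1)}(\omega;O_x)>0$ if and only if $F(\omega;O_x)>0$. -/

import Mathlib

open scoped MatrixOrder ComplexOrder

/-! A lattice spin system on a set of sites `Λ`: the site `v` carries the finite-dimensional
Hilbert space `ℂ ^ (d v)`, and the region `A` (a finite set of sites) carries the tensor product
`⨂_{v ∈ A} ℂ ^ (d v)`, whose product basis is indexed by the configurations `Cfg d A`. -/

namespace LatticeSystem

noncomputable section Regions

/-- Basis configurations of a region `A`. -/
abbrev Cfg {Λ : Type*} (d : Λ → ℕ) (A : Finset Λ) : Type _ := (v : A) → Fin (d v)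

/-- Operators on the Hilbert space of the region `A`. -/
abbrev Op {Λ : Type*} (d : Λ → ℕ) (A : Finset Λ) : Type _ := Matrix (Cfg d A) (Cfg d A) ℂ

/-- Basis configurations of the whole lattice. -/
abbrev GCfg {Λ : Type*} (d : Λ → ℕ) : Type _ := (v : Λ) → Fin (d v)

variable {Λ : Type*} [DecidableEq Λ] {d : Λ → ℕ}

/-- The restriction to `A ⊆ B` of a configuration of `B`. -/
def res {A B : Finset Λ} (h : A ⊆ B) (s : Cfg d B) : Cfg d A := fun v => s ⟨v.1, h v.2⟩

/-- Glue a configuration of `A ⊆ B` and a configuration of `B \ A` to a configuration of `B`. -/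
def glue {A B : Finset Λ} (s : Cfg d A) (c : Cfg d (B \ A)) : Cfg d B := fun v =>
  if h : v.1 ∈ A then s ⟨v.1, h⟩ else c ⟨v.1, Finset.mem_sdiff.2 ⟨v.2, h⟩⟩

/-- The operator `O ⊗ 𝟙` on the region `B`, for `O` an operator on `A ⊆ B`. -/
def extend {A B : Finset Λ} (h : A ⊆ B) (O : Op d A) : Op d B :=
  Matrix.of fun s t =>
    O (res h s) (res h t) *
      (if res (Finset.sdiff_subset : B \ A ⊆ B) s = res Finset.sdiff_subset t then 1 else 0)

/-- The partial trace `Tr_{B \ A}`. -/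
def partialTrace {A B : Finset Λ} (_h : A ⊆ B) (ρ : Op d B) : Op d A :=
  Matrix.of fun s t => ∑ c : Cfg d (B \ A), ρ (glue s c) (glue t c)

/-- A mixed state (density matrix) on a finite region. -/
structure IsDensityMatrix {A : Finset Λ} (ρ : Op d A) : Prop where
  posSemidef : ρ.PosSemidef
  trace_eq_one : ρ.trace = 1

end Regions

noncomputable section Correlators

variable {n : Type*} [Fintype n] [DecidableEq n]

/-- The operator norm `‖O‖_∞` on the Hilbert space `ℂⁿ`. -/
def opNorm (O : Matrix n n ℂ) : ℝ := ‖Matrix.toEuclideanCLM (n := n) (𝕜 := ℂ) O‖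

/-- The fidelity `F(ρ, σ) = Tr √(√ρ σ √ρ)`. -/
def fidelity (ρ σ : Matrix n n ℂ) : ℝ :=
  (CFC.sqrt (CFC.sqrt ρ * σ * CFC.sqrt ρ)).trace.re

/-- The one-point fidelity correlator `F(ρ; O) = F(ρ, O ρ O†)`. -/
def fidelityCorr (ρ O : Matrix n n ℂ) : ℝ := fidelity ρ (O * ρ * O.conjTranspose)

/-- The one-point Rényi-1 correlator `R⁽¹⁾(ρ; O) = Tr (√ρ O √ρ O†)`. -/
def renyiCorr (ρ O : Matrix n n ℂ) : ℝ :=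
  (CFC.sqrt ρ * O * CFC.sqrt ρ * O.conjTranspose).trace.re

/-- The trace defining the fidelity is real, so that taking its real part loses nothing. -/
theorem coe_fidelity (ρ σ : Matrix n n ℂ) :
    ((fidelity ρ σ : ℝ) : ℂ) = (CFC.sqrt (CFC.sqrt ρ * σ * CFC.sqrt ρ)).trace := by
  have h : (CFC.sqrt (CFC.sqrt ρ * σ * CFC.sqrt ρ)).PosSemidef := 
    Matrix.nonneg_iff_posSemidef.1 (CFC.sqrt_nonneg _)
  have h2 := (Complex.le_def.1 h.trace_nonneg).2
  apply Complex.ext <;> simp_all [fidelity]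

/-- The trace defining the Rényi-1 correlator is real, so that taking its real part loses
nothing. -/
theorem coe_renyiCorr (ρ O : Matrix n n ℂ) :
    ((renyiCorr ρ O : ℝ) : ℂ) =
      (CFC.sqrt ρ * O * CFC.sqrt ρ * O.conjTranspose).trace := by
  have hs : (CFC.sqrt ρ).IsHermitian := (Matrix.nonneg_iff_posSemidef.1 (CFC.sqrt_nonneg ρ)).1
  have h : star (CFC.sqrt ρ * O * CFC.sqrt ρ * O.conjTranspose).trace =
      (CFC.sqrt ρ * O * CFC.sqrt ρ * O.conjTranspose).trace := by
    rw [← Matrix.trace_conjTranspose]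
    simp only [Matrix.conjTranspose_mul, Matrix.conjTranspose_conjTranspose, hs.eq]
    rw [Matrix.trace_mul_comm]
    simp only [Matrix.mul_assoc]
    rw [Matrix.trace_mul_comm (CFC.sqrt ρ)]
    simp only [Matrix.mul_assoc]
    rw [Matrix.trace_mul_comm]
    simp only [Matrix.mul_assoc]
  exact Complex.conj_eq_iff_re.1 h

end Correlators

/-! The quasi-local algebra. Local operators are represented faithfully on `ℓ²` of the set of all
configurations of the lattice, an operator `O` on `A` acting on the coordinates in `A` only; the
quasi-local C⋆-algebra is the norm closure of the algebra of local operators. -/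

noncomputable section QuasiLocal

variable {Λ : Type*} [DecidableEq Λ] {d : Λ → ℕ}

/-- The carrier space of the representation. -/
abbrev HSpace (d : Λ → ℕ) : Type _ := lp (fun _ : GCfg d => ℂ) 2

/-- Replace the coordinates in `A` of `s` by those of `t`. -/
def upd {A : Finset Λ} (s : GCfg d) (t : Cfg d A) : GCfg d := fun v =>
  if h : v ∈ A then t ⟨v, h⟩ else s v

theorem restrict_upd {A : Finset Λ} (s : GCfg d) (t : Cfg d A) : A.restrict (upd s t) = t := by
  funext v; simp [upd]

theorem upd_upd {A : Finset Λ} (s : GCfg d) (t u : Cfg d A) : upd (upd s t) u = upd s u := by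
  funext v; by_cases h : v ∈ A <;> simp [upd, h]

theorem upd_restrict {A : Finset Λ} (s : GCfg d) : upd s (A.restrict s) = s := by
  funext v; by_cases h : v ∈ A <;> simp [upd, h]

/-- Configurations that agree with `i` on `A` correspond to those that agree with `j` on `A`. -/
def fiberEquiv {A : Finset Λ} (i j : Cfg d A) :
    {s : GCfg d | A.restrict s = i} ≃ {s : GCfg d | A.restrict s = j} where
  toFun s := ⟨upd s.1 j, restrict_upd _ _⟩
  invFun s := ⟨upd s.1 i, restrict_upd _ _⟩
  left_inv s := by
    ext1
    have h : A.restrict s.1 = i := s.2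
    have h2 := upd_restrict (A := A) s.1
    rw [h] at h2
    simp only [upd_upd]
    exact h2
  right_inv s := by
    ext1
    have h : A.restrict s.1 = j := s.2
    have h2 := upd_restrict (A := A) s.1
    rw [h] at h2
    simp only [upd_upd]
    exact h2

theorem summable_fiber {A : Finset Λ} (i j : Cfg d A) {f : GCfg d → ℝ} (hf : Summable f) :
    Summable fun s => if A.restrict s = i then f (upd s j) else 0 := by
  have h1 : Summable fun s : {s : GCfg d | A.restrict s = i} => f (upd s.1 j) :=
    ((fiberEquiv i j).summable_iff
      (f := fun u : {s : GCfg d | A.restrict s = j} => f u.1)).2 (hf.subtype _)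
  have h2 := (summable_subtype_iff_indicator
    (f := fun s => f (upd s j)) (s := {s : GCfg d | A.restrict s = i})).1 h1
  refine h2.congr fun s => ?_
  simp [Set.indicator_apply]

theorem tsum_fiber {A : Finset Λ} {E : Type*} [NormedAddCommGroup E]
    (i j : Cfg d A) (f : GCfg d → E) :
    (∑' s, if A.restrict s = i then f (upd s j) else 0) =
      ∑' s, if A.restrict s = j then f s else 0 := by
  have h1 : ∑' s : {s : GCfg d | A.restrict s = i}, f (upd s.1 j) =
      ∑' u : {s : GCfg d | A.restrict s = j}, f u.1 :=
    (fiberEquiv i j).tsum_eq (fun u => f u.1)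
  rw [tsum_subtype {s : GCfg d | A.restrict s = i} (fun s => f (upd s j)),
    tsum_subtype {s : GCfg d | A.restrict s = j} f] at h1
  simpa [Set.indicator_apply] using h1

/-- The matrix unit `|i⟩⟨j| ⊗ 𝟙` of the region `A`, acting on the carrier space. -/
def unitOp {A : Finset Λ} (i j : Cfg d A) : HSpace d →L[ℂ] HSpace d :=
  LinearMap.mkContinuous
    { toFun := fun ψ => ⟨fun s => if A.restrict s = i then ψ (upd s j) else 0, by
        refine memℓp_gen ?_
        have h := summable_fiber i j ((lp.memℓp ψ).summable (by norm_num))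
        refine h.congr fun s => ?_
        split_ifs <;> simp⟩
      map_add' := fun ψ φ => by
        ext s
        simp only [lp.coeFn_add, Pi.add_apply]
        split_ifs <;> simp
      map_smul' := fun c ψ => by
        ext s
        simp only [lp.coeFn_smul, Pi.smul_apply, RingHom.id_apply]
        split_ifs <;> simp }
    1 (fun ψ => by
      rw [one_mul]
      have hsum := (lp.memℓp ψ).summable (p := 2) (by norm_num)
      have h2 : (0 : ℝ) < (2 : ENNReal).toReal := by norm_num
      rw [← Real.rpow_le_rpow_iff (norm_nonneg _) (norm_nonneg _) h2,
        lp.norm_rpow_eq_tsum h2, lp.norm_rpow_eq_tsum h2]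
      have h3 := tsum_fiber i j (fun s => ‖ψ s‖ ^ (2 : ENNReal).toReal)
      have h4 : (∑' s, if A.restrict s = j then ‖ψ s‖ ^ (2 : ENNReal).toReal else 0) ≤
          ∑' s, ‖ψ s‖ ^ (2 : ENNReal).toReal := by
        have h5 := hsum.indicator {s : GCfg d | A.restrict s = j}
        refine Summable.tsum_le_tsum (fun s => ?_) (h5.congr fun s => ?_) hsum
        · split_ifs
          · exact le_rfl
          · positivity
        · simp [Set.indicator_apply]
      refine le_trans (le_of_eq ?_) h4
      rw [← h3]
      refine tsum_congr fun s => ?_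
      simp only [LinearMap.coe_mk, AddHom.coe_mk]
      split_ifs <;> simp)

theorem unitOp_apply {A : Finset Λ} (i j : Cfg d A) (ψ : HSpace d) (s : GCfg d) :
    unitOp i j ψ s = if A.restrict s = i then ψ (upd s j) else 0 := rfl

theorem star_unitOp {A : Finset Λ} (i j : Cfg d A) :
    star (unitOp (d := d) i j) = unitOp j i := by
  rw [ContinuousLinearMap.star_eq_adjoint]
  symm
  rw [ContinuousLinearMap.eq_adjoint_iff]
  intro ψ φ
  rw [lp.inner_eq_tsum, lp.inner_eq_tsum]
  have h := tsum_fiber j i (fun s => inner ℂ (ψ s) (φ (upd s j)))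
  calc _ = ∑' s, (if A.restrict s = j then
        inner ℂ (ψ (upd s i)) (φ (upd (upd s i) j)) else 0) := by
        refine tsum_congr fun s => ?_
        rw [unitOp_apply]
        split_ifs with hs
        · rw [upd_upd, ← hs, upd_restrict]
        · simp
    _ = _ := by
        rw [h]
        refine tsum_congr fun s => ?_
        rw [unitOp_apply]
        split_ifs <;> simp

/-- The action on the carrier space of a matrix over the configurations of `A`. -/
def localFun {A : Finset Λ} (O : Op d A) : HSpace d →L[ℂ] HSpace d :=
  ∑ i, ∑ j, O i j • unitOp i j

theorem localFun_apply {A : Finset Λ} (O : Op d A) (ψ : HSpace d) (s : GCfg d) :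
    localFun O ψ s = ∑ j, O (A.restrict s) j * ψ (upd s j) := by
  have h : localFun O ψ s = ∑ i, ∑ j, O i j * unitOp i j ψ s := by
    simp only [localFun, _root_.sum_apply, lp.coeFn_sum, Finset.sum_apply,
      _root_.smul_apply, lp.coeFn_smul, Pi.smul_apply, smul_eq_mul]
  rw [h, Finset.sum_eq_single (A.restrict s)]
  · simp [unitOp_apply]
  · intro i _ hi
    simp [unitOp_apply, Ne.symm hi]
  · simp

/-- The faithful representation `O ↦ O ⊗ 𝟙` of the operators on `A`. -/
def localOp (A : Finset Λ) : Op d A →⋆ₐ[ℂ] (HSpace d →L[ℂ] HSpace d) where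
  toFun := localFun
  map_one' := by
    ext ψ s
    simp [localFun_apply, Matrix.one_apply, upd_restrict]
  map_mul' M N := by
    ext ψ s
    change localFun (M * N) ψ s = localFun M (localFun N ψ) s
    simp only [localFun_apply, Matrix.mul_apply, restrict_upd,
      upd_upd, Finset.sum_mul, Finset.mul_sum]
    rw [Finset.sum_comm]
    simp [mul_assoc]
  map_zero' := by
    ext ψ s
    simp [localFun_apply]
  map_add' M N := by
    ext ψ s
    simp [localFun_apply, add_mul, Finset.sum_add_distrib]
  commutes' c := by
    ext ψ s
    simp [localFun_apply, Matrix.algebraMap_matrix_apply, upd_restrict]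
  map_star' O := by
    simp only [localFun, star_sum, star_smul, star_unitOp, Matrix.star_apply]
    rw [Finset.sum_comm]

theorem localOp_apply {A : Finset Λ} (O : Op d A) (ψ : HSpace d) (s : GCfg d) :
    localOp A O ψ s = ∑ j, O (A.restrict s) j * ψ (upd s j) := localFun_apply O ψ s

/-- The quasi-local algebra: the norm closure of the star algebra of all local operators. -/
def quasiLocal (d : Λ → ℕ) : StarSubalgebra ℂ (HSpace d →L[ℂ] HSpace d) :=
  (⨆ A : Finset Λ, (localOp (d := d) A).range).topologicalClosure

/-- A local operator as an element of the quasi-local algebra. -/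
def toQuasiLocal (A : Finset Λ) (O : Op d A) : quasiLocal d :=
  ⟨localOp A O, StarSubalgebra.le_topologicalClosure _
    ((le_iSup (fun A : Finset Λ => (localOp (d := d) A).range) A) ⟨O, rfl⟩)⟩

/-- A state of the lattice system: a normalized positive linear functional on the quasi-local
algebra. -/
structure QState (d : Λ → ℕ) where
  toFun : quasiLocal d →L[ℂ] ℂ
  nonneg : ∀ a : quasiLocal d, 0 ≤ toFun (star a * a)
  map_one : toFun 1 = 1

/-- The reduced density matrix of the state `ω` on the finite region `A`, that is the unique
matrix `ρ_A` with `ω(O) = Tr (ρ_A O)` for all operators `O` on `A`. -/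
def QState.reduced (ω : QState d) (A : Finset Λ) : Op d A :=
  Matrix.of fun i j => ω.toFun (toQuasiLocal A (Matrix.single j i 1))

theorem QState.reduced_eq_iff (ω : QState d) (A : Finset Λ) (ρ : Op d A) :
    ρ = ω.reduced A ↔ ∀ O : Op d A, ω.toFun (toQuasiLocal A O) = (ρ * O).trace := by
  constructor
  · rintro rfl O
    have h : toQuasiLocal A O =
        ∑ i, ∑ j, O i j • toQuasiLocal A (Matrix.single i j (1 : ℂ)) := by
      apply Subtype.ext
      have h2 : O = ∑ i, ∑ j, O i j • Matrix.single i j (1 : ℂ) := by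
        conv_lhs => rw [Matrix.matrix_eq_sum_single O]
        simp
      simp only [AddSubmonoidClass.coe_finsetSum, SetLike.val_smul]
      change localOp A O = ∑ i, ∑ j, O i j • localOp A (Matrix.single i j (1 : ℂ))
      conv_lhs => rw [h2]
      simp only [map_sum, map_smul]
    rw [h]
    simp only [map_sum, map_smul, Matrix.trace, Matrix.diag_apply, Matrix.mul_apply,
      QState.reduced, Matrix.of_apply, smul_eq_mul]
    rw [Finset.sum_comm]
    simp [mul_comm]
  · intro h
    ext i j
    simp [QState.reduced, h, Matrix.trace_mul_single]

/-- `A ↦ R⁽¹⁾(ρ_A; O)` for a state `ω` and an operator `O` on the finite set of sites `S`, with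
the (irrelevant) value `0` at regions `A` that do not contain `S`. -/
def QState.renyi (ω : QState d) {S : Finset Λ} (O : Op d S) (A : Finset Λ) : ℝ :=
  if h : S ⊆ A then renyiCorr (ω.reduced A) (extend h O) else 0

/-- `A ↦ F(ρ_A; O)` for a state `ω` and an operator `O` on the finite set of sites `S`, with
the (irrelevant) value `0` at regions `A` that do not contain `S`. -/
def QState.fid (ω : QState d) {S : Finset Λ} (O : Op d S) (A : Finset Λ) : ℝ :=
  if h : S ⊆ A then fidelityCorr (ω.reduced A) (extend h O) else 0

end QuasiLocal

section Coverings

variable {Λ : Type*} [MetricSpace Λ]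

/-- A covering centered at `x`: an increasing sequence of finite regions containing `x` such that
the distance from `x` to the complement diverges. -/
structure IsCovering (x : Λ) (A : ℕ → Finset Λ) : Prop where
  mem : ∀ n, x ∈ A n
  mono : Monotone A
  dist_tendsto : Filter.Tendsto (fun n => Metric.infEDist x ((A n : Set Λ)ᶜ)) Filter.atTop (nhds ⊤)

/-- `l` is the covering limit at `x` of the function `f` of regions: the limit of `f` along
every covering centered at `x`. -/
def IsCoveringLimit (x : Λ) (f : Finset Λ → ℝ) (l : ℝ) : Prop :=
  ∀ A : ℕ → Finset Λ, IsCovering x A → Filter.Tendsto (fun n => f (A n)) Filter.atTop (nhds l)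

end Coverings

end LatticeSystem

/-! Everything is reduced to the Cauchy–Schwarz inequality for the Hilbert–Schmidt norm `hsSq`.

Comparison of the correlators. `F(ρ; O)` is the trace norm of `√ρ O √ρ`. Hence `R⁽¹⁾ = Tr (O† √ρ O
√ρ) ≤ ‖O‖ F` by duality of operator and trace norm. Conversely `F = Tr (U √ρ O √ρ)` for a partial
isometry `U`. With `r = ρ^(1/4)` this is `Tr ((r U r)(r O r))`, where `‖r O r‖² = R⁽¹⁾` and `‖r U
r‖² ≤ 1`, so `F² ≤ R⁽¹⁾`.

Monotonicity of `R⁽¹⁾` (`renyiCorr_extend_le`). For `ρ` on `B` and `Y`, `Z` on `A`, the Hermitian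
form `Tr (Y† √ρ Z √ρ)` satisfies `|Tr (Y† √ρ Z √ρ)|² ≤ ‖√ρ Y‖² ‖Z √ρ‖²`. The right side is linear in
`ρ` in each factor, so it depends on `ρ_A` only. In matrix units of an eigenbasis of `ρ_A` the two
factors are diagonal forms with weights `μ_i` and `μ_j`. A Hermitian form so dominated lies below
their geometric mean (`re_form_le`), and the form with weights `√(μ_i μ_j)` is the Rényi-1 form of
`ρ_A`.

Monotonicity of `F` (`fidelity_le_fidelity_partialTrace`). `F(ρ, σ)` is the trace of `√σ U √ρ` for a
partial isometry `U`. The partial trace of this matrix is again dominated by the reduced states,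
hence of the form `√σ_A C √ρ_A` with a contraction `C`, and its trace is at most `F(ρ_A, σ_A)`.

Limits. The reduced matrices of a lattice state are consistent density matrices, so both correlators
decrease along the directed set of finite regions and are bounded below by `0`. They converge along
this net, and every covering is cofinal in it. -/

namespace LatticeSystem

open Matrix

/-! ### Hilbert–Schmidt norm, pseudoinverses and the trace norm -/

section HilbertSchmidt

variable {n : Type*} [Fintype n]

/-- The squared Hilbert–Schmidt norm of a matrix. -/
def hsSq (M : Matrix n n ℂ) : ℝ := (Mᴴ * M).trace.re

theorem hsSq_eq_sum (M : Matrix n n ℂ) : hsSq M = ∑ p : n × n, ‖M p.1 p.2‖ ^ 2 := by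
  rw [Fintype.sum_prod_type, Finset.sum_comm]
  simp only [hsSq, trace, diag_apply, mul_apply, conjTranspose_apply, Complex.re_sum]
  refine Finset.sum_congr rfl fun i _ => Finset.sum_congr rfl fun j _ => ?_
  rw [Complex.star_def, ← Complex.normSq_eq_conj_mul_self, Complex.ofReal_re,
    Complex.normSq_eq_norm_sq]

theorem hsSq_nonneg (M : Matrix n n ℂ) : 0 ≤ hsSq M := by
  rw [hsSq_eq_sum]; positivity

theorem hsSq_eq_zero {M : Matrix n n ℂ} : hsSq M = 0 ↔ M = 0 := by
  rw [hsSq_eq_sum, Finset.sum_eq_zero_iff_of_nonneg fun _ _ => by positivity]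
  constructor
  · intro h
    ext i j
    simpa using h (i, j) (Finset.mem_univ _)
  · rintro rfl
    simp

theorem coe_hsSq (M : Matrix n n ℂ) : (hsSq M : ℂ) = (Mᴴ * M).trace :=
  Complex.ext rfl (Complex.le_def.1 (posSemidef_conjTranspose_mul_self M).trace_nonneg).2

theorem hsSq_eq_re_trace_mul_conjTranspose (M : Matrix n n ℂ) :
    hsSq M = (M * Mᴴ).trace.re := by
  rw [hsSq, trace_mul_comm]

theorem hsSq_conjTranspose (M : Matrix n n ℂ) : hsSq Mᴴ = hsSq M := by
  rw [hsSq, conjTranspose_conjTranspose, hsSq_eq_re_trace_mul_conjTranspose]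

/-- The Cauchy–Schwarz inequality for the Hilbert–Schmidt inner product. -/
theorem norm_trace_conjTranspose_mul_sq_le (A B : Matrix n n ℂ) :
    ‖(Aᴴ * B).trace‖ ^ 2 ≤ hsSq A * hsSq B := by
  have h : ‖(Aᴴ * B).trace‖ ≤ ∑ p : n × n, ‖A p.1 p.2‖ * ‖B p.1 p.2‖ := by
    rw [Fintype.sum_prod_type, Finset.sum_comm]
    simp only [trace, diag_apply, mul_apply, conjTranspose_apply]
    refine (norm_sum_le _ _).trans (Finset.sum_le_sum fun i _ => (norm_sum_le _ _).trans
      (Finset.sum_le_sum fun j _ => ?_))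
    rw [norm_mul, norm_star]
  rw [hsSq_eq_sum, hsSq_eq_sum]
  exact (pow_le_pow_left₀ (norm_nonneg _) h 2).trans (Finset.sum_mul_sq_le_sq_mul_sq _ _ _)

theorem norm_trace_mul_sq_le (A B : Matrix n n ℂ) :
    ‖(A * B).trace‖ ^ 2 ≤ hsSq A * hsSq B := by
  have h := norm_trace_conjTranspose_mul_sq_le Aᴴ B
  rwa [conjTranspose_conjTranspose, hsSq_conjTranspose] at h

variable [DecidableEq n]

theorem hsSq_conj {V : Matrix n n ℂ} (hV : Vᴴ * V = 1) (Y : Matrix n n ℂ) :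
    hsSq (V * Y * Vᴴ) = hsSq Y := by
  rw [hsSq, conjTranspose_mul, conjTranspose_mul, conjTranspose_conjTranspose]
  calc _ = (V * (Yᴴ * (Vᴴ * V) * Y * Vᴴ)).trace.re := by simp only [Matrix.mul_assoc]
    _ = _ := by
      rw [trace_mul_comm, hV, Matrix.mul_one, Matrix.mul_assoc, hV, Matrix.mul_one, hsSq]

/-- Multiplication by a partial isometry does not increase the Hilbert–Schmidt norm. -/
theorem hsSq_mul_le_of_partialIsometry {U : Matrix n n ℂ} (hU : U * Uᴴ * U = U)
    (Z : Matrix n n ℂ) : hsSq (U * Z) ≤ hsSq Z := by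
  -- `Uᴴ * U` is an orthogonal projection, so by Pythagoras the defect `‖Z‖² - ‖U Z‖²` is the
  -- squared norm of the complementary part.
  have h : ((1 - Uᴴ * U) * Z)ᴴ * ((1 - Uᴴ * U) * Z) = Zᴴ * Z - (U * Z)ᴴ * (U * Z) := by
    have h1 : Uᴴ * U * (Uᴴ * U) = Uᴴ * U := by
      rw [Matrix.mul_assoc, ← Matrix.mul_assoc U, hU]
    have h2 : (1 - Uᴴ * U) * (1 - Uᴴ * U) = 1 - Uᴴ * U := by
      simp only [mul_sub, sub_mul, h1]; simp
    have h3 : (1 - Uᴴ * U)ᴴ = 1 - Uᴴ * U := by simp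
    rw [conjTranspose_mul, h3, Matrix.mul_assoc, ← Matrix.mul_assoc (1 - _), h2]
    simp only [sub_mul, mul_sub, conjTranspose_mul, Matrix.mul_assoc, one_mul]
  have h4 := hsSq_nonneg ((1 - Uᴴ * U) * Z)
  rw [hsSq, h, trace_sub, Complex.sub_re] at h4
  simpa [hsSq] using h4

theorem hsSq_mul_le_of_partialIsometry' {U : Matrix n n ℂ} (hU : U * Uᴴ * U = U)
    (Z : Matrix n n ℂ) : hsSq (Z * U) ≤ hsSq Z := by
  have h := hsSq_mul_le_of_partialIsometry (U := Uᴴ) (by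
    have := congrArg conjTranspose hU
    simpa [Matrix.mul_assoc] using this) Zᴴ
  rwa [← conjTranspose_mul, hsSq_conjTranspose, hsSq_conjTranspose] at h

/-- A diagonalization of a Hermitian matrix. -/
theorem exists_diagonalization {P : Matrix n n ℂ} (hP : P.IsHermitian) :
    ∃ (V : Matrix n n ℂ) (μ : n → ℝ), Vᴴ * V = 1 ∧ V * Vᴴ = 1 ∧
      P = V * diagonal (fun i => (μ i : ℂ)) * Vᴴ ∧ (P.PosSemidef → ∀ i, 0 ≤ μ i) := by
  refine ⟨hP.eigenvectorUnitary, hP.eigenvalues, ?_, ?_, ?_, fun h => h.eigenvalues_nonneg⟩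
  · exact Unitary.coe_star_mul_self hP.eigenvectorUnitary
  · exact Unitary.coe_mul_star_self hP.eigenvectorUnitary
  · have := hP.spectral_theorem
    rw [Unitary.conjStarAlgAut_apply] at this
    exact this

/-- Every Hermitian matrix has a Hermitian pseudoinverse. -/
theorem exists_pseudoinverse {P : Matrix n n ℂ} (hP : P.IsHermitian) :
    ∃ Q : Matrix n n ℂ, Q.IsHermitian ∧ P * Q = Q * P ∧ P * Q * P = P ∧ Q * P * Q = Q := by
  obtain ⟨V, μ, h1, -, rfl, -⟩ := exists_diagonalization hP
  have key : ∀ D E : Matrix n n ℂ, V * D * Vᴴ * (V * E * Vᴴ) = V * (D * E) * Vᴴ := by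
    intro D E
    calc _ = V * D * (Vᴴ * V) * E * Vᴴ := by simp only [Matrix.mul_assoc]
      _ = _ := by rw [h1]; simp only [Matrix.mul_assoc, one_mul]
  -- Nonzero eigenvalues are inverted; the convention `0⁻¹ = 0` handles the kernel.
  refine ⟨V * diagonal (fun i => ((μ i)⁻¹ : ℂ)) * Vᴴ, ?_, ?_, ?_, ?_⟩
  · refine isHermitian_mul_mul_conjTranspose _ ?_
    rw [IsHermitian, diagonal_conjTranspose]
    congr 1
    ext i
    simp
  · simp only [key, diagonal_mul_diagonal, mul_comm]
  · simp only [key, diagonal_mul_diagonal, mul_inv_mul_cancel]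
  · simp only [key, diagonal_mul_diagonal]
    congr 3
    ext i
    by_cases h : (μ i : ℂ) = 0 <;> simp [h]

theorem posSemidef_sqrt (ρ : Matrix n n ℂ) : (CFC.sqrt ρ).PosSemidef :=
  nonneg_iff_posSemidef.1 (CFC.sqrt_nonneg ρ)

theorem conjTranspose_sqrt (ρ : Matrix n n ℂ) : (CFC.sqrt ρ)ᴴ = CFC.sqrt ρ :=
  (posSemidef_sqrt ρ).1

theorem sqrt_mul_sqrt {ρ : Matrix n n ℂ} (hρ : ρ.PosSemidef) : CFC.sqrt ρ * CFC.sqrt ρ = ρ :=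
  CFC.sqrt_mul_sqrt_self ρ (nonneg_iff_posSemidef.2 hρ)

/-- The square root disappears: the squared norm is linear in `ρ`, which lets it pass to reduced
density matrices. -/
theorem hsSq_sqrt_mul {ρ : Matrix n n ℂ} (hρ : ρ.PosSemidef) (Z : Matrix n n ℂ) :
    hsSq (CFC.sqrt ρ * Z) = (ρ * (Z * Zᴴ)).trace.re := by
  rw [hsSq, conjTranspose_mul, conjTranspose_sqrt, Matrix.mul_assoc, ← Matrix.mul_assoc (CFC.sqrt ρ),
    sqrt_mul_sqrt hρ, trace_mul_comm, Matrix.mul_assoc]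

theorem hsSq_mul_sqrt {ρ : Matrix n n ℂ} (hρ : ρ.PosSemidef) (Z : Matrix n n ℂ) :
    hsSq (Z * CFC.sqrt ρ) = (ρ * (Zᴴ * Z)).trace.re := by
  rw [← hsSq_conjTranspose, conjTranspose_mul, conjTranspose_sqrt, hsSq_sqrt_mul hρ,
    conjTranspose_conjTranspose]

/-- The trace norm `Tr √(T T†)` of a matrix. -/
noncomputable def traceNorm (T : Matrix n n ℂ) : ℝ := (CFC.sqrt (T * Tᴴ)).trace.re

theorem traceNorm_nonneg (T : Matrix n n ℂ) : 0 ≤ traceNorm T :=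
  (Complex.le_def.1 (posSemidef_sqrt _).trace_nonneg).1

/-- The trace norm is attained on a partial isometry. -/
theorem exists_partialIsometry_trace_eq (T : Matrix n n ℂ) :
    ∃ U : Matrix n n ℂ, U * Uᴴ * U = U ∧ (U * T).trace.re = traceNorm T := by
  obtain ⟨Q, hQ, hc, h1, h2⟩ := exists_pseudoinverse (posSemidef_sqrt (T * Tᴴ)).1
  have hP := sqrt_mul_sqrt (posSemidef_self_mul_conjTranspose T)
  rw [traceNorm]
  set P := CFC.sqrt (T * Tᴴ)
  have h3 : Q * (T * Tᴴ) * Q = P * Q := by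
    rw [← hP, ← Matrix.mul_assoc, ← hc, h1, hc]
  -- In the polar decomposition `T = P (Q T)` the polar part is `Q T`; the witness is its adjoint.
  refine ⟨Tᴴ * Q, ?_, ?_⟩
  · rw [conjTranspose_mul, conjTranspose_conjTranspose, hQ.eq]
    calc Tᴴ * Q * (Q * T) * (Tᴴ * Q) = Tᴴ * Q * (Q * (T * Tᴴ) * Q) := by
          simp only [Matrix.mul_assoc]
      _ = Tᴴ * (Q * P * Q) := by rw [h3]; simp only [Matrix.mul_assoc]
      _ = _ := by rw [h2]
  · rw [trace_mul_comm, ← Matrix.mul_assoc, ← hP, Matrix.mul_assoc, hc, ← Matrix.mul_assoc, h1]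

/-- Duality of the trace norm and the operator norm. -/
theorem norm_trace_mul_le_traceNorm {C : Matrix n n ℂ} {c : ℝ} (hc0 : 0 ≤ c)
    (hC : ∀ Z, hsSq (C * Z) ≤ c ^ 2 * hsSq Z) (T : Matrix n n ℂ) :
    ‖(C * T).trace‖ ≤ c * traceNorm T := by
  obtain ⟨Q, hQ, hc, h1, h2⟩ := exists_pseudoinverse (posSemidef_sqrt (T * Tᴴ)).1
  have hP := sqrt_mul_sqrt (posSemidef_self_mul_conjTranspose T)
  have hPs := posSemidef_sqrt (T * Tᴴ)
  have h0 := traceNorm_nonneg T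
  rw [traceNorm] at h0 ⊢
  set P := CFC.sqrt (T * Tᴴ)
  -- `P * Q` projects onto the range of `P`, which contains that of `T` because `P² = T Tᴴ`.
  have hT : T = P * Q * T := by
    have h3 : (1 - P * Q) * T * ((1 - P * Q) * T)ᴴ = 0 := by
      rw [conjTranspose_mul, Matrix.mul_assoc, ← Matrix.mul_assoc T, ← hP, Matrix.mul_assoc P,
        ← Matrix.mul_assoc, sub_mul, h1, one_mul, sub_self, zero_mul]
    rw [self_mul_conjTranspose_eq_zero, sub_mul, one_mul, sub_eq_zero] at h3
    exact h3
  have hq := sqrt_mul_sqrt hPs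
  have hqs := conjTranspose_sqrt P
  set q := CFC.sqrt P
  have h4 : hsSq q = P.trace.re := by rw [hsSq, hqs, hq]
  have h5 : hsSq (q * (Q * T)) = P.trace.re := by
    rw [hsSq_eq_re_trace_mul_conjTranspose]
    congr 1
    calc _ = (q * (Q * (T * Tᴴ) * Q * q)).trace := by
          simp only [conjTranspose_mul, hQ.eq, hqs, Matrix.mul_assoc]
      _ = (Q * (P * P) * Q * P).trace := by
          rw [trace_mul_comm, hP, Matrix.mul_assoc _ q, hq]
      _ = _ := by
          rw [← Matrix.mul_assoc Q, ← hc, h1, h1]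
  -- Splitting `P = q * q` gives two factors, where `q` and `q Q T` both have squared norm `Tr P`.
  have h6 : C * T = C * q * (q * (Q * T)) := by
    conv_lhs => rw [hT, ← hq]
    simp only [Matrix.mul_assoc]
  have h7 := norm_trace_mul_sq_le (C * q) (q * (Q * T))
  rw [← h6, h5] at h7
  have h8 := hC q
  rw [h4] at h8
  refine (pow_le_pow_iff_left₀ (norm_nonneg _) (by positivity) two_ne_zero).1 (h7.trans ?_)
  calc _ ≤ c ^ 2 * P.trace.re * P.trace.re := mul_le_mul_of_nonneg_right h8 h0
    _ = _ := by ring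

end HilbertSchmidt

/-! ### Comparison of the two correlators; an upper bound for traces by the fidelity -/

section Correlators

variable {n : Type*} [Fintype n] [DecidableEq n]

theorem sqrt_mul_mul_conjTranspose {ρ : Matrix n n ℂ} (hρ : ρ.PosSemidef) (O : Matrix n n ℂ) :
    CFC.sqrt ρ * O * CFC.sqrt ρ * (CFC.sqrt ρ * O * CFC.sqrt ρ)ᴴ =
      CFC.sqrt ρ * (O * ρ * Oᴴ) * CFC.sqrt ρ := by
  simp only [conjTranspose_mul, conjTranspose_sqrt]
  conv_rhs => rw [← Matrix.mul_assoc, ← Matrix.mul_assoc, ← sqrt_mul_sqrt hρ]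
  simp only [sqrt_mul_sqrt hρ, Matrix.mul_assoc]
  rw [← Matrix.mul_assoc (CFC.sqrt ρ) (CFC.sqrt ρ), sqrt_mul_sqrt hρ]

theorem fidelityCorr_eq_traceNorm {ρ : Matrix n n ℂ} (hρ : ρ.PosSemidef) (O : Matrix n n ℂ) :
    fidelityCorr ρ O = traceNorm (CFC.sqrt ρ * O * CFC.sqrt ρ) := by
  rw [traceNorm, sqrt_mul_mul_conjTranspose hρ]
  rfl

theorem fidelity_eq_traceNorm (ρ : Matrix n n ℂ) {σ : Matrix n n ℂ} (hσ : σ.PosSemidef) :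
    fidelity ρ σ = traceNorm (CFC.sqrt ρ * CFC.sqrt σ) := by
  rw [traceNorm, conjTranspose_mul, conjTranspose_sqrt, conjTranspose_sqrt, Matrix.mul_assoc,
    ← Matrix.mul_assoc (CFC.sqrt σ), sqrt_mul_sqrt hσ, ← Matrix.mul_assoc]
  rfl

theorem fidelityCorr_nonneg (ρ O : Matrix n n ℂ) : 0 ≤ fidelityCorr ρ O :=
  (Complex.le_def.1 (posSemidef_sqrt _).trace_nonneg).1

/-- Cauchy–Schwarz is used twice: once for `Tr ((r U r)(r O r))` with `r = ρ^(1/4)`, and once for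
`‖r U r‖² = Tr (U √ρ Uᴴ √ρ) ≤ 1`, where the normalization `Tr ρ = 1` enters. -/
theorem fidelityCorr_sq_le_renyiCorr {ρ : Matrix n n ℂ} (hρ : ρ.PosSemidef)
    (htr : ρ.trace = 1) (O : Matrix n n ℂ) : fidelityCorr ρ O ^ 2 ≤ renyiCorr ρ O := by
  rw [fidelityCorr_eq_traceNorm hρ]
  obtain ⟨U, hU, hUT⟩ := exists_partialIsometry_trace_eq (CFC.sqrt ρ * O * CFC.sqrt ρ)
  have hr := sqrt_mul_sqrt (posSemidef_sqrt ρ)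
  have hrs := conjTranspose_sqrt (CFC.sqrt ρ)
  have hs := conjTranspose_sqrt ρ
  have hs1 : hsSq (CFC.sqrt ρ) = 1 := by
    rw [hsSq, hs, sqrt_mul_sqrt hρ, htr, Complex.one_re]
  rw [← hUT, renyiCorr]
  set s := CFC.sqrt ρ
  set r := CFC.sqrt s
  have hW : hsSq (r * O * r) = (s * O * s * Oᴴ).trace.re := by
    rw [hsSq_eq_re_trace_mul_conjTranspose]
    simp only [conjTranspose_mul, hrs]
    congr 1
    calc _ = (r * (O * (r * r) * Oᴴ * r)).trace := by simp only [Matrix.mul_assoc]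
      _ = (O * s * Oᴴ * s).trace := by
        rw [trace_mul_comm, hr, Matrix.mul_assoc _ r r, hr]
      _ = _ := by rw [trace_mul_comm]; simp only [Matrix.mul_assoc]
  have hV : hsSq (r * U * r) = ((Uᴴ * s)ᴴ * (s * Uᴴ)).trace.re := by
    rw [hsSq_eq_re_trace_mul_conjTranspose]
    simp only [conjTranspose_mul, hrs, hs, conjTranspose_conjTranspose]
    congr 1
    calc _ = (r * (U * (r * r) * Uᴴ * r)).trace := by simp only [Matrix.mul_assoc]
      _ = (U * s * Uᴴ * s).trace := by
        rw [trace_mul_comm, hr, Matrix.mul_assoc _ r r, hr]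
      _ = _ := by rw [trace_mul_comm]; simp only [Matrix.mul_assoc]
  have hU1 : hsSq (Uᴴ * s) ≤ 1 := by
    rw [← hsSq_conjTranspose, conjTranspose_mul, conjTranspose_conjTranspose, hs, ← hs1]
    exact hsSq_mul_le_of_partialIsometry' hU _
  have hU2 : hsSq (s * Uᴴ) ≤ 1 := by
    rw [← hsSq_conjTranspose, conjTranspose_mul, conjTranspose_conjTranspose, hs, ← hs1]
    exact hsSq_mul_le_of_partialIsometry hU _
  have hV1 : hsSq (r * U * r) ≤ 1 := by
    have h := norm_trace_conjTranspose_mul_sq_le (Uᴴ * s) (s * Uᴴ)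
    have h2 := (Complex.re_le_norm ((Uᴴ * s)ᴴ * (s * Uᴴ)).trace)
    have h3 := mul_le_one₀ hU1 (hsSq_nonneg _) hU2
    rw [hV]
    exact h2.trans ((sq_le_one_iff₀ (norm_nonneg _)).1 (h.trans h3))
  have hfac : (U * (s * O * s)).trace = (r * U * r * (r * O * r)).trace := by
    calc _ = (U * r * (r * O * r) * r).trace := by
          rw [← hr]; simp only [Matrix.mul_assoc]
      _ = _ := by rw [trace_mul_comm]; simp only [Matrix.mul_assoc]
  rw [hfac, ← hW]
  calc _ ≤ ‖(r * U * r * (r * O * r)).trace‖ ^ 2 := by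
        rw [← sq_abs]
        exact pow_le_pow_left₀ (abs_nonneg _) (Complex.abs_re_le_norm _) 2
    _ ≤ hsSq (r * U * r) * hsSq (r * O * r) := norm_trace_mul_sq_le _ _
    _ ≤ _ := mul_le_of_le_one_left (hsSq_nonneg _) hV1

/-- Hölder's inequality for `Tr (Oᴴ (√ρ O √ρ))`. Right multiplication by `O` and left multiplication
by `Oᴴ` obey the same bound, by taking adjoints. -/
theorem renyiCorr_le_mul_fidelityCorr {ρ O : Matrix n n ℂ} (hρ : ρ.PosSemidef) {c : ℝ}
    (hc : 0 ≤ c) (hO : ∀ Z, hsSq (Z * O) ≤ c ^ 2 * hsSq Z) :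
    renyiCorr ρ O ≤ c * fidelityCorr ρ O := by
  rw [fidelityCorr_eq_traceNorm hρ, renyiCorr, trace_mul_comm]
  refine (Complex.re_le_norm _).trans (norm_trace_mul_le_traceNorm hc (fun Z => ?_) _)
  have h := hO Zᴴ
  rwa [hsSq_conjTranspose, ← hsSq_conjTranspose, conjTranspose_mul,
    conjTranspose_conjTranspose] at h

/-- Uhlmann's bound: a matrix `X` that is dominated by `σ` on the left and by `ρ` on the right
has trace at most the fidelity of `ρ` and `σ`. -/
theorem re_trace_le_fidelity {ρ σ X : Matrix n n ℂ} (hσ : σ.PosSemidef)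
    (hX : ∀ Y Z : Matrix n n ℂ, ‖(Yᴴ * X * Z).trace‖ ^ 2 ≤
      hsSq (CFC.sqrt σ * Y) * hsSq (CFC.sqrt ρ * Z)) :
    X.trace.re ≤ fidelity ρ σ := by
  rw [fidelity_eq_traceNorm ρ hσ]
  have hs := conjTranspose_sqrt σ
  have hr := conjTranspose_sqrt ρ
  set s := CFC.sqrt σ
  set r := CFC.sqrt ρ
  obtain ⟨s', hs', hsc, hs1, hs2⟩ := exists_pseudoinverse hs
  obtain ⟨r', hr', hrc, hr1, hr2⟩ := exists_pseudoinverse hr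
  -- `1 - r' * r` is annihilated by `r`, so the domination forces `X` to vanish on it; `Y` is chosen
  -- to make the trace a squared norm. The next step does the same on the left.
  have hXr : X = X * (r' * r) := by
    have h := hX (X * (1 - r' * r)) (1 - r' * r)
    have h2 : r * (1 - r' * r) = 0 := by
      rw [mul_sub, mul_one, ← Matrix.mul_assoc, hr1, sub_self]
    rw [h2, hsSq_eq_zero.2 rfl, mul_zero, Matrix.mul_assoc, ← coe_hsSq, Complex.norm_real,
      Real.norm_eq_abs, sq_abs] at h
    have h3 := hsSq_eq_zero.1 (pow_eq_zero_iff two_ne_zero |>.1 (h.antisymm (sq_nonneg _)))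
    rwa [mul_sub, mul_one, sub_eq_zero] at h3
  have hXs : X = s * s' * X := by
    have h := hX (1 - s' * s) ((1 - s * s') * X)ᴴ
    have h2 : s * (1 - s' * s) = 0 := by
      rw [mul_sub, mul_one, ← Matrix.mul_assoc, hs1, sub_self]
    have h3 : (1 - s' * s)ᴴ = 1 - s * s' := by
      rw [conjTranspose_sub, conjTranspose_mul, conjTranspose_one, hs, hs'.eq]
    rw [h2, hsSq_eq_zero.2 rfl, zero_mul, h3] at h
    have h4 := coe_hsSq ((1 - s * s') * X)ᴴ
    rw [conjTranspose_conjTranspose] at h4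
    rw [← h4, Complex.norm_real, Real.norm_eq_abs, sq_abs] at h
    have h3 := hsSq_eq_zero.1 (pow_eq_zero_iff two_ne_zero |>.1 (h.antisymm (sq_nonneg _)))
    rwa [conjTranspose_eq_zero, sub_mul, one_mul, sub_eq_zero] at h3
  have hproj : ∀ {p q : Matrix n n ℂ}, pᴴ = p → q.IsHermitian → p * q = q * p → p * q * p = p →
      ∀ Z, hsSq (p * (q * Z)) ≤ hsSq Z := by
    intro p q hp hq hc h1 Z
    rw [← Matrix.mul_assoc]
    have h2 : p * q * (p * q) = p * q := by rw [← Matrix.mul_assoc, h1]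
    refine hsSq_mul_le_of_partialIsometry ?_ Z
    rw [conjTranspose_mul, hp, hq.eq, ← hc, h2, h2]
  -- With `W = s' X r' Z`, the domination at `s' W` and `r' Z` reads `‖W‖⁴ ≤ ‖W‖² ‖Z‖²`; hence `s' X
  -- r'` is a contraction.
  have hC : ∀ Z, hsSq (s' * X * r' * Z) ≤ 1 ^ 2 * hsSq Z := by
    intro Z
    have h := hX (s' * (s' * X * r' * Z)) (r' * Z)
    have h2 : (s' * (s' * X * r' * Z))ᴴ * X * (r' * Z) =
        (s' * X * r' * Z)ᴴ * (s' * X * r' * Z) := by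
      rw [conjTranspose_mul, hs'.eq]
      simp only [Matrix.mul_assoc]
    rw [h2, ← coe_hsSq, Complex.norm_real, Real.norm_eq_abs, sq_abs] at h
    have h3 := h.trans (mul_le_mul (hproj hs hs' hsc hs1 _) (hproj hr hr' hrc hr1 _)
      (hsSq_nonneg _) (hsSq_nonneg _))
    rw [one_pow, one_mul]
    rcases (hsSq_nonneg (s' * X * r' * Z)).eq_or_lt with h0 | h0
    · rw [← h0]; exact hsSq_nonneg _
    · rw [sq] at h3
      exact le_of_mul_le_mul_left h3 h0
  have htr : X.trace = (s' * X * r' * (r * s)).trace := by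
    have h : X = s * (s' * X * r' * r) := by
      conv_lhs => rw [hXs, hXr]
      simp only [Matrix.mul_assoc]
    conv_lhs => rw [h, trace_mul_comm]
    simp only [Matrix.mul_assoc]
  rw [htr]
  have h := norm_trace_mul_le_traceNorm zero_le_one hC (r * s)
  rw [one_mul] at h
  exact (Complex.re_le_norm _).trans h

end Correlators

/-! ### Tensor extension, partial trace and monotonicity of the fidelity -/

section Tensor

variable {Λ : Type*} [DecidableEq Λ] {d : Λ → ℕ} {A B C : Finset Λ}

theorem res_glue (h : A ⊆ B) (s : Cfg d A) (c : Cfg d (B \ A)) : res h (glue s c) = s := by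
  funext v
  simp [res, glue, v.2]

theorem res_sdiff_glue (s : Cfg d A) (c : Cfg d (B \ A)) :
    res Finset.sdiff_subset (glue s c) = c := by
  funext v
  simp [res, glue, (Finset.mem_sdiff.1 v.2).2]

theorem glue_res (h : A ⊆ B) (s : Cfg d B) :
    glue (res h s) (res (Finset.sdiff_subset : B \ A ⊆ B) s) = s := by
  funext v
  by_cases hv : v.1 ∈ A <;> simp [res, glue, hv]

/-- A configuration of `B` is a pair of configurations of `A ⊆ B` and `B \ A`. -/
def cfgEquiv (h : A ⊆ B) : Cfg d B ≃ Cfg d A × Cfg d (B \ A) where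
  toFun s := (res h s, res Finset.sdiff_subset s)
  invFun p := glue p.1 p.2
  left_inv := glue_res h
  right_inv _ := Prod.ext (res_glue h _ _) (res_sdiff_glue _ _)

open scoped Kronecker in
theorem extend_eq_submatrix (h : A ⊆ B) (O : Op d A) :
    extend h O = (O ⊗ₖ (1 : Op d (B \ A))).submatrix (cfgEquiv h) (cfgEquiv h) := by
  ext s t
  simp [extend, cfgEquiv, one_apply]

theorem extend_mul (h : A ⊆ B) (O P : Op d A) : extend h (O * P) = extend h O * extend h P := by
  simp only [extend_eq_submatrix, submatrix_mul_equiv, ← mul_kronecker_mul, one_mul]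

theorem extend_one (h : A ⊆ B) : extend h (1 : Op d A) = 1 := by
  rw [extend_eq_submatrix, one_kronecker_one, submatrix_one_equiv]

theorem extend_conjTranspose (h : A ⊆ B) (O : Op d A) : extend h Oᴴ = (extend h O)ᴴ := by
  rw [extend_eq_submatrix, extend_eq_submatrix, conjTranspose_submatrix,
    conjTranspose_kronecker, conjTranspose_one]

theorem extend_add (h : A ⊆ B) (O P : Op d A) : extend h (O + P) = extend h O + extend h P := by
  ext s t
  simp only [extend, of_apply, Matrix.add_apply, add_mul]

theorem extend_smul (h : A ⊆ B) (c : ℂ) (O : Op d A) : extend h (c • O) = c • extend h O := by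
  ext s t
  simp [extend]

theorem extend_sub (h : A ⊆ B) (O P : Op d A) : extend h (O - P) = extend h O - extend h P := by
  ext s t
  simp only [extend, of_apply, Matrix.sub_apply, sub_mul]

theorem extend_extend (hAB : A ⊆ B) (hBC : B ⊆ C) (O : Op d A) :
    extend hBC (extend hAB O) = extend (hAB.trans hBC) O := by
  ext s t
  have h : (res (Finset.sdiff_subset : C \ A ⊆ C) s = res Finset.sdiff_subset t) ↔
      (res (Finset.sdiff_subset : B \ A ⊆ B) (res hBC s) =
          res Finset.sdiff_subset (res hBC t)) ∧
        res (Finset.sdiff_subset : C \ B ⊆ C) s = res Finset.sdiff_subset t := by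
    simp only [funext_iff, res, Subtype.forall, Finset.mem_sdiff]
    constructor
    · intro h
      exact ⟨fun v hv => h v ⟨hBC hv.1, hv.2⟩, fun v hv => h v ⟨hv.1, fun h => hv.2 (hAB h)⟩⟩
    · rintro ⟨h1, h2⟩ v hv
      by_cases hvB : v ∈ B
      · exact h1 v ⟨hvB, hv.2⟩
      · exact h2 v ⟨hv.1, hvB⟩
  simp only [extend, of_apply, h, ite_and, mul_assoc]
  congr 1
  split_ifs <;> simp

/-- The partial trace is dual to `O ↦ O ⊗ 𝟙`. -/
theorem trace_partialTrace_mul (h : A ⊆ B) (M : Op d B) (W : Op d A) :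
    (partialTrace h M * W).trace = (M * extend h W).trace := by
  have hR : (M * extend h W).trace = ∑ p : Cfg d A × Cfg d (B \ A),
      ∑ q : Cfg d A × Cfg d (B \ A), M (glue p.1 p.2) (glue q.1 q.2) *
        (W q.1 p.1 * if q.2 = p.2 then 1 else 0) := by
    simp only [trace, diag_apply, mul_apply]
    rw [← (cfgEquiv h).symm.sum_comp]
    refine Finset.sum_congr rfl fun p _ => ?_
    rw [← (cfgEquiv h).symm.sum_comp]
    refine Finset.sum_congr rfl fun q _ => ?_
    simp [cfgEquiv, extend, res_glue, res_sdiff_glue]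
  rw [hR]
  simp only [trace, diag_apply, mul_apply, partialTrace, of_apply, Fintype.sum_prod_type,
    mul_ite, mul_one, mul_zero, Finset.sum_ite_eq', Finset.mem_univ, if_true, Finset.sum_mul]
  refine Finset.sum_congr rfl fun s _ => ?_
  rw [Finset.sum_comm]

theorem eq_of_trace_mul_eq {n : Type*} [Fintype n] [DecidableEq n] {M N : Matrix n n ℂ}
    (h : ∀ W, (M * W).trace = (N * W).trace) : M = N := by
  ext i j
  simpa [trace_mul_single] using h (single j i 1)

theorem partialTrace_partialTrace (hAB : A ⊆ B) (hBC : B ⊆ C) (M : Op d C) :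
    partialTrace hAB (partialTrace hBC M) = partialTrace (hAB.trans hBC) M := by
  refine eq_of_trace_mul_eq fun W => ?_
  simp only [trace_partialTrace_mul, extend_extend]

/-- Operators supported on `A` pass through the partial trace. In particular the reduction of `O ρ
O†` is `O ρ_A O†`. -/
theorem partialTrace_extend_mul_mul (h : A ⊆ B) (O P : Op d A) (M : Op d B) :
    partialTrace h (extend h O * M * extend h P) = O * partialTrace h M * P := by
  refine eq_of_trace_mul_eq fun W => ?_
  calc _ = (extend h O * (M * extend h P * extend h W)).trace := by
        rw [trace_partialTrace_mul]; simp only [Matrix.mul_assoc]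
    _ = (M * extend h (P * W * O)).trace := by
        rw [trace_mul_comm]; simp only [Matrix.mul_assoc, extend_mul]
    _ = (partialTrace h M * (P * W) * O).trace := by
        rw [← trace_partialTrace_mul]; simp only [Matrix.mul_assoc]
    _ = _ := by rw [trace_mul_comm]; simp only [Matrix.mul_assoc]

theorem trace_partialTrace (h : A ⊆ B) (M : Op d B) : (partialTrace h M).trace = M.trace := by
  simpa [extend_one] using trace_partialTrace_mul h M 1

theorem posSemidef_partialTrace (h : A ⊆ B) {M : Op d B} (hM : M.PosSemidef) :
    (partialTrace h M).PosSemidef := by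
  have h1 : partialTrace h M = ∑ c : Cfg d (B \ A),
      M.submatrix (fun s => glue s c) (fun s => glue s c) := by
    ext s t
    simp [partialTrace, Matrix.sum_apply]
  rw [h1]
  exact posSemidef_sum _ fun c _ => hM.submatrix _

theorem IsDensityMatrix.partialTrace (h : A ⊆ B) {ρ : Op d B} (hρ : IsDensityMatrix ρ) :
    IsDensityMatrix (partialTrace h ρ) :=
  ⟨posSemidef_partialTrace h hρ.posSemidef, (trace_partialTrace h ρ).trans hρ.trace_eq_one⟩

/-- Both sides equal the expectation of `Z Zᴴ`, an operator on `A`, which the partial trace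
preserves. -/
theorem hsSq_sqrt_partialTrace_mul (h : A ⊆ B) {ρ : Op d B} (hρ : ρ.PosSemidef) (Z : Op d A) :
    hsSq (CFC.sqrt (partialTrace h ρ) * Z) = hsSq (CFC.sqrt ρ * extend h Z) := by
  rw [hsSq_sqrt_mul hρ, hsSq_sqrt_mul (posSemidef_partialTrace h hρ), trace_partialTrace_mul,
    extend_mul, extend_conjTranspose]

theorem hsSq_mul_sqrt_partialTrace (h : A ⊆ B) {ρ : Op d B} (hρ : ρ.PosSemidef) (Z : Op d A) :
    hsSq (Z * CFC.sqrt (partialTrace h ρ)) = hsSq (extend h Z * CFC.sqrt ρ) := by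
  rw [hsSq_mul_sqrt hρ, hsSq_mul_sqrt (posSemidef_partialTrace h hρ), trace_partialTrace_mul,
    extend_mul, extend_conjTranspose]

/-- Monotonicity of the fidelity under the partial trace. -/
theorem fidelity_le_fidelity_partialTrace (h : A ⊆ B) {ρ σ : Op d B} (hρ : ρ.PosSemidef)
    (hσ : σ.PosSemidef) :
    fidelity ρ σ ≤ fidelity (partialTrace h ρ) (partialTrace h σ) := by
  obtain ⟨U, hU, hUT⟩ := exists_partialIsometry_trace_eq (CFC.sqrt ρ * CFC.sqrt σ)
  have h1 : fidelity ρ σ = (partialTrace h (CFC.sqrt σ * U * CFC.sqrt ρ)).trace.re := by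
    rw [fidelity_eq_traceNorm ρ hσ, ← hUT, trace_partialTrace, ← Matrix.mul_assoc,
      trace_mul_comm, Matrix.mul_assoc]
  rw [h1]
  -- The reduced matrix inherits the domination: Cauchy–Schwarz on `B`, after which each norm is
  -- computed on `A`.
  refine re_trace_le_fidelity (posSemidef_partialTrace h hσ) fun Y Z => ?_
  have h2 : (Yᴴ * partialTrace h (CFC.sqrt σ * U * CFC.sqrt ρ) * Z).trace =
      ((CFC.sqrt σ * extend h Y)ᴴ * (U * (CFC.sqrt ρ * extend h Z))).trace := by
    rw [← partialTrace_extend_mul_mul, trace_partialTrace, conjTranspose_mul, conjTranspose_sqrt,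
      extend_conjTranspose]
    simp only [Matrix.mul_assoc]
  rw [h2, hsSq_sqrt_partialTrace_mul h hσ, hsSq_sqrt_partialTrace_mul h hρ]
  exact (norm_trace_conjTranspose_mul_sq_le _ _).trans
    (mul_le_mul_of_nonneg_left (hsSq_mul_le_of_partialIsometry hU _) (hsSq_nonneg _))

theorem fidelityCorr_extend_le (h : A ⊆ B) {ρ : Op d B} (hρ : ρ.PosSemidef) (O : Op d A) :
    fidelityCorr ρ (extend h O) ≤ fidelityCorr (partialTrace h ρ) O := by
  have h1 := fidelity_le_fidelity_partialTrace h hρ (hρ.mul_mul_conjTranspose_same (extend h O))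
  rwa [← extend_conjTranspose, partialTrace_extend_mul_mul, extend_conjTranspose] at h1

end Tensor

/-! ### Hermitian forms below a geometric mean -/

section HermitianForm

variable {ι : Type*} [Fintype ι] [DecidableEq ι]

/-- If a Hermitian form `H` satisfies `|⟨y, H z⟩|² ≤ ⟨y, P y⟩ ⟨z, Q z⟩` for positive diagonal
`P` and `Q`, then `H` is at most the geometric mean of `P` and `Q`. -/
theorem re_form_le_of_pos {H : Matrix ι ι ℂ} (hH : H.IsHermitian) {p q : ι → ℝ}
    (hp : ∀ i, 0 < p i) (hq : ∀ i, 0 < q i)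
    (hb : ∀ y z : ι → ℂ, ‖star y ⬝ᵥ H *ᵥ z‖ ^ 2 ≤
      (∑ i, p i * ‖y i‖ ^ 2) * ∑ i, q i * ‖z i‖ ^ 2) (x : ι → ℂ) :
    (star x ⬝ᵥ H *ᵥ x).re ≤ ∑ i, √(p i * q i) * ‖x i‖ ^ 2 := by
  set w : ι → ℝ := fun i => √(p i * q i)
  have hw : ∀ i, 0 < w i := fun i => Real.sqrt_pos.2 (mul_pos (hp i) (hq i))
  set u : ι → ℝ := fun i => √(w i)
  have hu : ∀ i, 0 < u i := fun i => Real.sqrt_pos.2 (hw i)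
  have huu : ∀ i, u i * u i = w i := fun i => Real.mul_self_sqrt (hw i).le
  have huc : ∀ i, (u i : ℂ) ≠ 0 := fun i => by exact_mod_cast (hu i).ne'
  set D : Matrix ι ι ℂ := diagonal fun i => ((u i)⁻¹ : ℂ)
  have hD : Dᴴ = D := by
    rw [diagonal_conjTranspose]
    congr 1
    ext i
    simp
  have hN : (1 - D * H * D).IsHermitian := by
    refine isHermitian_one.sub ?_
    have := isHermitian_mul_mul_conjTranspose D hH
    rwa [hD] at this
  -- After rescaling by `D = w^(-1/2)` with `w = √(p q)` the claim is `D H D ≤ 1`. It suffices to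
  -- exclude a negative eigenvalue `η` of `1 - D H D`.
  have hpsd : (1 - D * H * D).PosSemidef := by
    rw [hN.posSemidef_iff_eigenvalues_nonneg]
    intro k
    set η := hN.eigenvalues k
    set v : ι → ℂ := ⇑(hN.eigenvectorBasis k)
    have hv : (1 - D * H * D) *ᵥ v = (η : ℂ) • v := by
      have := hN.mulVec_eigenvectorBasis k
      simpa using this
    have hv0 : v ≠ 0 := by
      intro h0
      have h1 := hN.eigenvectorBasis.orthonormal.ne_zero k
      apply h1
      ext i
      exact congrFun h0 i
    set z : ι → ℂ := fun i => (u i : ℂ)⁻¹ * v i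
    have hDv : D *ᵥ v = z := by
      ext i
      simp [D, mulVec_diagonal, z]
    have hHz : ∀ i, (H *ᵥ z) i = (1 - η) * (w i * z i) := by
      intro i
      have h1 := congrFun hv i
      rw [sub_mulVec, one_mulVec, ← mulVec_mulVec, ← mulVec_mulVec, hDv] at h1
      simp only [Pi.sub_apply, Pi.smul_apply, smul_eq_mul, D, mulVec_diagonal] at h1
      have h2 : (u i : ℂ)⁻¹ * (H *ᵥ z) i = (1 - η) * v i := by linear_combination -h1
      rw [← huu]
      push_cast
      have h3 : (u i : ℂ) * z i = v i := mul_inv_cancel_left₀ (huc i) _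
      have h4 : (u i : ℂ) * (u i : ℂ)⁻¹ = 1 := mul_inv_cancel₀ (huc i)
      linear_combination (u i : ℂ) * h2 - (H *ᵥ z) i * h4 - (1 - η) * (u i : ℂ) * h3
    set K : ℝ := ∑ i, q i * ‖z i‖ ^ 2
    have hK : 0 < K := by
      obtain ⟨i, hi⟩ := Function.ne_iff.1 hv0
      refine Finset.sum_pos' (fun i _ => mul_nonneg (hq i).le (sq_nonneg _))
        ⟨i, Finset.mem_univ _, mul_pos (hq i) ?_⟩
      have : z i ≠ 0 := mul_ne_zero (inv_ne_zero (huc i)) hi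
      positivity
    -- The weight `√(q/p)` balances the two factors: it gives `∑ p ‖y‖² = K`, and `√(q/p) w = q`
    -- gives `⟨y, H z⟩ = (1 - η) K`. The hypothesis becomes `(1 - η)² K² ≤ K²`, impossible for `η <
    -- 0`.
    set y : ι → ℂ := fun i => ((√(q i) / √(p i) : ℝ) : ℂ) * z i
    have hsq : ∀ i, √(q i) / √(p i) * w i = q i := by
      intro i
      have := Real.sqrt_pos.2 (hp i)
      simp only [w]
      rw [Real.sqrt_mul (hp i).le, div_mul_eq_mul_div, div_eq_iff this.ne']
      nlinarith [Real.mul_self_sqrt (hq i).le]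
    have h1 : star y ⬝ᵥ H *ᵥ z = (((1 - η) * K : ℝ) : ℂ) := by
      simp only [dotProduct, Pi.star_apply, hHz, K]
      push_cast
      rw [Finset.mul_sum]
      refine Finset.sum_congr rfl fun i _ => ?_
      have h3 : star (z i) * z i = ((‖z i‖ ^ 2 : ℝ) : ℂ) := by
        rw [Complex.star_def, Complex.conj_mul']; push_cast; rfl
      have h4 := congrArg (fun r : ℝ => (r : ℂ)) (hsq i)
      push_cast at h3 h4
      simp only [y, star_mul', Complex.star_def, Complex.conj_ofReal] at h3 ⊢
      push_cast
      rw [← h3, ← h4]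
      ring
    have h2 : ∑ i, p i * ‖y i‖ ^ 2 = K := by
      refine Finset.sum_congr rfl fun i _ => ?_
      have := hp i
      rw [norm_mul, Complex.norm_real, Real.norm_eq_abs, mul_pow, sq_abs, div_pow,
        Real.sq_sqrt (hq i).le, Real.sq_sqrt (hp i).le]
      field_simp
    have h3 := hb y z
    change _ ≤ _ * K at h3
    rw [h1, h2, Complex.norm_real, Real.norm_eq_abs, sq_abs] at h3
    by_contra hneg
    have h4 : η < 0 := not_le.1 hneg
    nlinarith [mul_pos hK hK, mul_pos (neg_pos.2 h4) (mul_pos hK hK), sq_nonneg (η * K)]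
  have h1 := (hpsd.dotProduct_mulVec_nonneg (fun i => (u i : ℂ) * x i))
  have hDx : D *ᵥ (fun i => (u i : ℂ) * x i) = x := by
    ext i
    simp [D, mulVec_diagonal, huc i]
  have h2 : star (fun i => (u i : ℂ) * x i) ⬝ᵥ (D * H * D) *ᵥ (fun i => (u i : ℂ) * x i) =
      star x ⬝ᵥ H *ᵥ x := by
    rw [← mulVec_mulVec, ← mulVec_mulVec, hDx, dotProduct_mulVec]
    nth_rw 1 [← hD]
    rw [← star_mulVec, hDx]
  rw [sub_mulVec, one_mulVec, dotProduct_sub, h2] at h1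
  have h3 := (Complex.le_def.1 h1).1
  rw [Complex.sub_re, Complex.zero_re, sub_nonneg] at h3
  refine h3.trans (le_of_eq ?_)
  simp only [dotProduct, Complex.re_sum, Pi.star_apply]
  refine Finset.sum_congr rfl fun i _ => ?_
  rw [Complex.star_def, Complex.conj_mul', ← Complex.ofReal_pow, Complex.ofReal_re, norm_mul,
    mul_pow, Complex.norm_real, Real.norm_eq_abs, sq_abs, sq (u i), huu]

/-- Zero weights are reached by applying the positive case to `p + ε` and `q + ε` and letting `ε`
tend to `0`. -/
theorem re_form_le {H : Matrix ι ι ℂ} (hH : H.IsHermitian) {p q : ι → ℝ}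
    (hp : ∀ i, 0 ≤ p i) (hq : ∀ i, 0 ≤ q i)
    (hb : ∀ y z : ι → ℂ, ‖star y ⬝ᵥ H *ᵥ z‖ ^ 2 ≤
      (∑ i, p i * ‖y i‖ ^ 2) * ∑ i, q i * ‖z i‖ ^ 2) (x : ι → ℂ) :
    (star x ⬝ᵥ H *ᵥ x).re ≤ ∑ i, √(p i * q i) * ‖x i‖ ^ 2 := by
  have hlim : Filter.Tendsto (fun ε : ℝ => ∑ i, √((p i + ε) * (q i + ε)) * ‖x i‖ ^ 2)
      (nhdsWithin 0 (Set.Ioi 0)) (nhds (∑ i, √((p i + 0) * (q i + 0)) * ‖x i‖ ^ 2)) := by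
    refine Filter.Tendsto.mono_left (Continuous.tendsto ?_ 0) nhdsWithin_le_nhds
    fun_prop
  simp only [add_zero] at hlim
  refine ge_of_tendsto hlim ?_
  filter_upwards [self_mem_nhdsWithin] with ε hε
  have hε : 0 < ε := hε
  refine re_form_le_of_pos hH (fun i => by linarith [hp i]) (fun i => by linarith [hq i])
    (fun y z => (hb y z).trans ?_) x
  refine mul_le_mul
    (Finset.sum_le_sum fun i _ => mul_le_mul_of_nonneg_right (by linarith) (sq_nonneg _))
    (Finset.sum_le_sum fun i _ => mul_le_mul_of_nonneg_right (by linarith) (sq_nonneg _))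
    (Finset.sum_nonneg fun i _ => mul_nonneg (hq i) (sq_nonneg _))
    (Finset.sum_nonneg fun i _ => mul_nonneg (by linarith [hp i]) (sq_nonneg _))

end HermitianForm

/-! ### Monotonicity of the Rényi-1 correlator -/

section Renyi

variable {Λ : Type*} [DecidableEq Λ] {d : Λ → ℕ} {A B : Finset Λ}

/-- The square root of a diagonalized matrix. -/
theorem sqrt_conj_diagonal {n : Type*} [Fintype n] [DecidableEq n] {V : Matrix n n ℂ}
    (hV : Vᴴ * V = 1) {μ : n → ℝ} (hμ : ∀ i, 0 ≤ μ i) :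
    CFC.sqrt (V * diagonal (fun i => (μ i : ℂ)) * Vᴴ) =
      V * diagonal (fun i => (√(μ i) : ℂ)) * Vᴴ := by
  refine CFC.sqrt_unique ?_ ?_
  · calc _ = V * diagonal (fun i => (√(μ i) : ℂ)) * (Vᴴ * V) *
          diagonal (fun i => (√(μ i) : ℂ)) * Vᴴ := by simp only [Matrix.mul_assoc]
      _ = _ := by
        rw [hV, Matrix.mul_one, Matrix.mul_assoc V, diagonal_mul_diagonal]
        congr 3
        ext i
        rw [← Complex.ofReal_mul, Real.mul_self_sqrt (hμ i)]
  · rw [nonneg_iff_posSemidef]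
    refine PosSemidef.mul_mul_conjTranspose_same (posSemidef_diagonal_iff.2 fun i => ?_) V
    exact_mod_cast Real.sqrt_nonneg _

/-- Monotonicity of the Rényi-1 correlator under the partial trace. -/
theorem renyiCorr_extend_le (h : A ⊆ B) {ρ : Op d B} (hρ : ρ.PosSemidef) (O : Op d A) :
    renyiCorr ρ (extend h O) ≤ renyiCorr (partialTrace h ρ) O := by
  have hρA := posSemidef_partialTrace h hρ
  obtain ⟨V, μ, hV, hV', hd, hμ⟩ := exists_diagonalization hρA.1
  replace hμ := hμ hρA
  -- `L` parametrizes the operators on `A` by their entries in an eigenbasis of `ρ_A`, where left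
  -- and right multiplication by `√ρ_A` are both diagonal.
  have hL : ∃ L : (Cfg d A × Cfg d A → ℂ) →ₗ[ℂ] Op d B,
      ∀ z, L z = extend h (V * of (fun i j => z (i, j)) * Vᴴ) := by
    refine ⟨⟨⟨fun z => extend h (V * of (fun i j => z (i, j)) * Vᴴ), fun x y => ?_⟩,
      fun c x => ?_⟩, fun z => rfl⟩
    · rw [← extend_add]
      congr 1
      rw [← Matrix.add_mul, ← Matrix.mul_add]
      rfl
    · rw [RingHom.id_apply, ← extend_smul, ← Matrix.smul_mul,
        ← Matrix.mul_smul]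
      rfl
  obtain ⟨L, hL⟩ := hL
  set s := CFC.sqrt ρ
  have hs : sᴴ = s := conjTranspose_sqrt ρ
  set H : Matrix (Cfg d A × Cfg d A) (Cfg d A × Cfg d A) ℂ :=
    of fun p q => ((L (Pi.single p 1))ᴴ * s * L (Pi.single q 1) * s).trace
  have hform : ∀ y z, star y ⬝ᵥ H *ᵥ z = ((L y)ᴴ * s * L z * s).trace := by
    intro y z
    have hz : ∀ z, L z = ∑ p, z p • L (Pi.single p 1) := by
      intro z
      conv_lhs => rw [pi_eq_sum_univ' z]
      simp only [map_sum, map_smul]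
    rw [hz y, hz z]
    simp only [conjTranspose_sum, conjTranspose_smul, Finset.sum_mul, Finset.mul_sum,
      Matrix.smul_mul, Matrix.mul_smul, trace_sum, trace_smul, dotProduct, mulVec, H, of_apply, Pi.star_apply, smul_eq_mul]
    rw [Finset.sum_comm]
    refine Finset.sum_congr rfl fun p _ => Finset.sum_congr rfl fun q _ => ?_
    ring
  have hHerm : H.IsHermitian := by
    ext p q
    rw [conjTranspose_apply]
    simp only [H, of_apply]
    rw [← trace_conjTranspose]
    simp only [conjTranspose_mul, conjTranspose_conjTranspose, hs]
    rw [trace_mul_comm]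
    simp only [Matrix.mul_assoc]
  have hsqrt : CFC.sqrt (partialTrace h ρ) = V * diagonal (fun i => (√(μ i) : ℂ)) * Vᴴ := by
    rw [hd, sqrt_conj_diagonal hV hμ]
  have hleft : ∀ y, hsSq (s * L y) = ∑ p, μ p.1 * ‖y p‖ ^ 2 := by
    intro y
    set Y : Op d A := of fun i j => y (i, j)
    rw [hL, ← hsSq_sqrt_partialTrace_mul h hρ, hsqrt]
    have : hsSq (V * diagonal (fun i => (√(μ i) : ℂ)) * Vᴴ * (V * Y * Vᴴ)) =
        hsSq (diagonal (fun i => (√(μ i) : ℂ)) * Y) := by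
      have h1 : V * diagonal (fun i => (√(μ i) : ℂ)) * Vᴴ * (V * Y * Vᴴ) =
          V * (diagonal (fun i => (√(μ i) : ℂ)) * Y) * Vᴴ := by
        calc _ = V * diagonal (fun i => (√(μ i) : ℂ)) * (Vᴴ * V) * Y * Vᴴ := by
              simp only [Matrix.mul_assoc]
          _ = _ := by rw [hV]; simp only [Matrix.mul_assoc, Matrix.one_mul]
      rw [h1, hsSq_conj hV]
    rw [this, hsSq_eq_sum]
    refine Finset.sum_congr rfl fun p _ => ?_
    rw [diagonal_mul, norm_mul, mul_pow, Complex.norm_real, Real.norm_eq_abs, sq_abs,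
      Real.sq_sqrt (hμ _)]
    rfl
  have hright : ∀ z, hsSq (L z * s) = ∑ p, μ p.2 * ‖z p‖ ^ 2 := by
    intro y
    set Y : Op d A := of fun i j => y (i, j)
    rw [hL, ← hsSq_mul_sqrt_partialTrace h hρ, hsqrt]
    have : hsSq (V * Y * Vᴴ * (V * diagonal (fun i => (√(μ i) : ℂ)) * Vᴴ)) =
        hsSq (Y * diagonal (fun i => (√(μ i) : ℂ))) := by
      have h1 : V * Y * Vᴴ * (V * diagonal (fun i => (√(μ i) : ℂ)) * Vᴴ) =
          V * (Y * diagonal (fun i => (√(μ i) : ℂ))) * Vᴴ := by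
        calc _ = V * Y * (Vᴴ * V) * diagonal (fun i => (√(μ i) : ℂ)) * Vᴴ := by
              simp only [Matrix.mul_assoc]
          _ = _ := by rw [hV]; simp only [Matrix.mul_assoc, Matrix.one_mul]
      rw [h1, hsSq_conj hV]
    rw [this, hsSq_eq_sum]
    refine Finset.sum_congr rfl fun p _ => ?_
    rw [mul_diagonal, norm_mul, mul_pow, Complex.norm_real, Real.norm_eq_abs, sq_abs,
      Real.sq_sqrt (hμ _), mul_comm]
    rfl
  -- Cauchy–Schwarz for `√ρ Y` and `Z √ρ`, placing one root on each side.
  have hb : ∀ y z, ‖star y ⬝ᵥ H *ᵥ z‖ ^ 2 ≤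
      (∑ p, μ p.1 * ‖y p‖ ^ 2) * ∑ p, μ p.2 * ‖z p‖ ^ 2 := by
    intro y z
    rw [hform, ← hleft, ← hright]
    have h1 := norm_trace_conjTranspose_mul_sq_le (s * L y) (L z * s)
    rwa [conjTranspose_mul, hs, ← Matrix.mul_assoc] at h1
  set X : Op d A := Vᴴ * Oᴴ * V
  have hVX : V * X * Vᴴ = Oᴴ := by
    calc _ = V * Vᴴ * Oᴴ * (V * Vᴴ) := by simp only [X, Matrix.mul_assoc]
      _ = _ := by rw [hV', Matrix.one_mul, Matrix.mul_one]
  have hmain := re_form_le hHerm (fun p => hμ p.1) (fun p => hμ p.2) hb (fun p => X p.1 p.2)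
  have hLX : L (fun p => X p.1 p.2) = (extend h O)ᴴ := by
    rw [hL, ← extend_conjTranspose, ← hVX]
    rfl
  have hl : renyiCorr ρ (extend h O) =
      (star (fun p : Cfg d A × Cfg d A => X p.1 p.2) ⬝ᵥ H *ᵥ fun p => X p.1 p.2).re := by
    rw [hform, hLX, conjTranspose_conjTranspose, trace_mul_comm]
    simp only [renyiCorr, Matrix.mul_assoc, s]
  have hr : renyiCorr (partialTrace h ρ) O =
      ∑ p : Cfg d A × Cfg d A, √(μ p.1 * μ p.2) * ‖X p.1 p.2‖ ^ 2 := by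
    have hO : O = V * Xᴴ * Vᴴ := by
      have := congrArg conjTranspose hVX
      simp only [conjTranspose_mul, conjTranspose_conjTranspose] at this
      rw [← this, Matrix.mul_assoc]
    set D : Op d A := diagonal fun i => (√(μ i) : ℂ)
    have h1 : (CFC.sqrt (partialTrace h ρ) * O * CFC.sqrt (partialTrace h ρ) * Oᴴ).trace =
        (D * Xᴴ * (D * X)).trace := by
      calc _ = (V * D * (Vᴴ * V) * Xᴴ * (Vᴴ * V) * D * (Vᴴ * V) * X * Vᴴ).trace := by
            rw [hsqrt, ← hVX]
            nth_rw 1 [hO]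
            simp only [Matrix.mul_assoc]
        _ = (Vᴴ * V * (D * Xᴴ * (D * X))).trace := by
            rw [trace_mul_comm]
            simp only [hV, Matrix.mul_assoc, Matrix.one_mul]
            rw [← Matrix.mul_assoc, hV, Matrix.one_mul]
        _ = _ := by rw [hV, Matrix.one_mul]
    rw [renyiCorr, h1, Fintype.sum_prod_type, Finset.sum_comm]
    simp only [trace, diag_apply, mul_apply (M := D * Xᴴ), D, diagonal_mul, Complex.re_sum,
      conjTranspose_apply]
    refine Finset.sum_congr rfl fun i _ => Finset.sum_congr rfl fun j _ => ?_
    have h2 : (√(μ i) : ℂ) * star (X j i) * (√(μ j) * X j i) =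
        ((√(μ j) * √(μ i) * ‖X j i‖ ^ 2 : ℝ) : ℂ) := by
      push_cast
      rw [← Complex.conj_mul', Complex.star_def]
      ring
    rw [h2, Complex.ofReal_re, Real.sqrt_mul (hμ j)]
  rw [hl, hr]
  exact hmain

end Renyi

/-! ### Operator norm of an extended operator -/

section OpNorm

variable {Λ : Type*} [DecidableEq Λ] {d : Λ → ℕ} {A B : Finset Λ}

theorem opNorm_nonneg {n : Type*} [Fintype n] [DecidableEq n] (O : Matrix n n ℂ) :
    0 ≤ opNorm O := norm_nonneg _

-- The bound `O Oᴴ ≤ ‖O‖²` is stored as an algebraic identity, since this form survives tensoring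
-- with the identity.
open scoped Matrix.Norms.L2Operator in
theorem exists_opNorm_sq_sub_eq {n : Type*} [Fintype n] [DecidableEq n] (O : Matrix n n ℂ) :
    ∃ M : Matrix n n ℂ, ((opNorm O ^ 2 : ℝ) : ℂ) • 1 - O * Oᴴ = M * Mᴴ := by
  have h : O * Oᴴ ≤ algebraMap ℝ _ (opNorm O ^ 2) :=
    CStarAlgebra.mul_star_le_algebraMap_norm_sq (a := O)
  have h2 := nonneg_iff_posSemidef.1 (sub_nonneg.2 h)
  refine ⟨CFC.sqrt (algebraMap ℝ _ (opNorm O ^ 2) - O * Oᴴ), ?_⟩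
  rw [conjTranspose_sqrt, sqrt_mul_sqrt h2, Algebra.algebraMap_eq_smul_one]
  congr 1

/-- Extending that identity to `B` exhibits the difference of the two sides as `hsSq (Z * extend h
M)`. The constant is thus the norm of `O` on `S` itself, for every `B`. -/
theorem hsSq_mul_extend_le (h : A ⊆ B) (O : Op d A) (Z : Op d B) :
    hsSq (Z * extend h O) ≤ opNorm O ^ 2 * hsSq Z := by
  obtain ⟨M, hM⟩ := exists_opNorm_sq_sub_eq O
  have h1 := congrArg (fun N => (Z * extend h N * Zᴴ).trace.re) hM
  simp only [extend_sub, extend_smul, extend_one, extend_mul, extend_conjTranspose] at h1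
  have h2 : ∀ W : Op d B, (Z * (W * Wᴴ) * Zᴴ).trace.re = hsSq (Z * W) := by
    intro W
    rw [hsSq_eq_re_trace_mul_conjTranspose, conjTranspose_mul]
    simp only [Matrix.mul_assoc]
  rw [Matrix.mul_sub, Matrix.sub_mul, trace_sub, Complex.sub_re, h2, h2, Matrix.mul_smul, Matrix.smul_mul,
    Matrix.mul_one, trace_smul, smul_eq_mul, Complex.re_ofReal_mul,
    ← hsSq_eq_re_trace_mul_conjTranspose] at h1
  have := hsSq_nonneg (Z * extend h M)
  linarith

theorem IsDensityMatrix.correlator_bounds {S : Finset Λ} (h : S ⊆ A) {ρ : Op d A}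
    (hρ : IsDensityMatrix ρ) (O : Op d S) :
    fidelityCorr ρ (extend h O) ^ 2 ≤ renyiCorr ρ (extend h O) ∧
      renyiCorr ρ (extend h O) ≤ opNorm O * fidelityCorr ρ (extend h O) :=
  ⟨fidelityCorr_sq_le_renyiCorr hρ.posSemidef hρ.trace_eq_one _,
    renyiCorr_le_mul_fidelityCorr hρ.posSemidef (opNorm_nonneg O) (hsSq_mul_extend_le h O)⟩

end OpNorm

open Filter

/-! ### Reduced density matrices of a lattice state -/

section States

variable {Λ : Type*} [DecidableEq Λ] {d : Λ → ℕ} {A B S : Finset Λ}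

theorem upd_glue (h : A ⊆ B) (s : GCfg d) (t : Cfg d A) :
    upd s (glue t (res (Finset.sdiff_subset : B \ A ⊆ B) (B.restrict s))) = upd s t := by
  funext v
  by_cases hA : v ∈ A
  · simp [upd, glue, hA, h hA]
  · by_cases hB : v ∈ B <;> simp [upd, glue, res, hA, hB]

/-- In the sum over configurations of `B`, only those agreeing with `s` on `B \ A` contribute, and
gluing these into `s` changes `s` on `A` only. -/
theorem localOp_extend (h : A ⊆ B) (O : Op d A) : localOp B (extend h O) = localOp A O := by
  ext ψ s
  rw [localOp_apply, localOp_apply, ← (cfgEquiv h).symm.sum_comp, Fintype.sum_prod_type]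
  refine Finset.sum_congr rfl fun t _ => ?_
  rw [Finset.sum_eq_single (res Finset.sdiff_subset (B.restrict s))]
  · simp only [cfgEquiv, Equiv.coe_fn_symm_mk, extend, of_apply, res_glue, res_sdiff_glue,
      if_true, mul_one, upd_glue h]
    rfl
  · intro c _ hc
    simp [cfgEquiv, extend, res_sdiff_glue, Ne.symm hc]
  · simp

theorem toQuasiLocal_extend (h : A ⊆ B) (O : Op d A) :
    toQuasiLocal B (extend h O) = toQuasiLocal A O := Subtype.ext (localOp_extend h O)

theorem QState.apply_toQuasiLocal (ω : QState d) (A : Finset Λ) (O : Op d A) :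
    ω.toFun (toQuasiLocal A O) = (ω.reduced A * O).trace :=
  (ω.reduced_eq_iff A _).1 rfl O

theorem QState.partialTrace_reduced (ω : QState d) (h : A ⊆ B) :
    partialTrace h (ω.reduced B) = ω.reduced A := by
  rw [QState.reduced_eq_iff]
  intro O
  rw [trace_partialTrace_mul, ← ω.apply_toQuasiLocal, toQuasiLocal_extend]

theorem posSemidef_of_trace_mul_nonneg {n : Type*} [Fintype n] [DecidableEq n]
    {ρ : Matrix n n ℂ} (h : ∀ O : Matrix n n ℂ, 0 ≤ (ρ * (Oᴴ * O)).trace) : ρ.PosSemidef := by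
  have hx : ∀ x, 0 ≤ (ρ *ᵥ x) ⬝ᵥ star x := by
    intro x
    -- The choice makes `Oᴴ O` the rank-one matrix `|x⟩⟨x|`, so the trace becomes a value of the
    -- quadratic form.
    have h1 := h (CFC.sqrt (vecMulVec x (star x)))
    rwa [conjTranspose_sqrt, sqrt_mul_sqrt (posSemidef_vecMulVec_self_star x), mul_vecMulVec,
      trace_vecMulVec] at h1
  rw [← isPositive_toEuclideanLin_iff, LinearMap.isPositive_iff_complex]
  intro x
  have h1 : 0 ≤ inner ℂ (toEuclideanLin ρ x) x := by
    rw [← inner_conj_symm, EuclideanSpace.inner_eq_star_dotProduct]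
    exact star_nonneg_iff.2 (hx x.ofLp)
  have h2 := Complex.le_def.1 h1
  exact ⟨Complex.ext rfl h2.2, h2.1⟩

theorem QState.isDensityMatrix_reduced (ω : QState d) (A : Finset Λ) :
    IsDensityMatrix (ω.reduced A) := by
  refine ⟨posSemidef_of_trace_mul_nonneg fun O => ?_, ?_⟩
  · rw [← ω.apply_toQuasiLocal]
    have h : toQuasiLocal A (Oᴴ * O) = star (toQuasiLocal A O) * toQuasiLocal A O := by
      apply Subtype.ext
      change localOp A (star O * O) = star (localOp A O) * localOp A O
      rw [map_mul, map_star]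
    rw [h]
    exact ω.nonneg _
  · have h := ω.apply_toQuasiLocal A 1
    have h1 : toQuasiLocal A (1 : Op d A) = 1 := Subtype.ext (_root_.map_one (localOp (d := d) A))
    rw [h1, ω.map_one, Matrix.mul_one] at h
    exact h.symm

end States

/-! ### Limits along the net of finite regions -/

section Limits

/-- A site `b` lies at finite distance from `x`, so it cannot stay in the complement once the
distance to the complement exceeds `edist x b`; a finite region is therefore eventually absorbed. -/
theorem IsCovering.tendsto_atTop {Λ : Type*} [MetricSpace Λ] {x : Λ} {A : ℕ → Finset Λ}
    (hA : IsCovering x A) : Tendsto A atTop atTop := by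
  rw [Filter.tendsto_atTop]
  intro B
  have h : ∀ b ∈ B, ∀ᶠ n in atTop, b ∈ A n := by
    intro b _
    filter_upwards [hA.dist_tendsto.eventually (lt_mem_nhds (edist_lt_top x b))] with n hn
    by_contra hb
    exact absurd hn (not_lt.2 (Metric.infEDist_le_edist_of_mem (by simpa using hb)))
  filter_upwards [(Filter.eventually_all_finset B).2 h] with n hn b hb
  exact hn b hb

/-- A nonnegative function of regions that decreases on the regions containing `S` converges. -/
theorem exists_tendsto_of_antitone {Λ : Type*} [DecidableEq Λ] (S : Finset Λ)
    {f : Finset Λ → ℝ} (h0 : ∀ A, S ⊆ A → 0 ≤ f A)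
    (hf : ∀ A B, S ⊆ A → A ⊆ B → f B ≤ f A) : ∃ l, Tendsto f atTop (nhds l) := by
  -- Adding `S` makes the function antitone on all regions without changing it on those containing
  -- `S`, which are eventually all.
  have hanti : Antitone fun A => f (A ∪ S) := fun A B hAB =>
    hf _ _ Finset.subset_union_right (Finset.union_subset_union_left hAB)
  refine ⟨⨅ A, f (A ∪ S), (tendsto_atTop_ciInf hanti ⟨0, ?_⟩).congr' ?_⟩
  · rintro _ ⟨A, rfl⟩
    exact h0 _ Finset.subset_union_right
  · filter_upwards [eventually_ge_atTop S] with A hA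
    rw [Finset.union_eq_left.2 hA]

end Limits

/-! ### Convergence of the correlators of a lattice state -/

section States

variable {Λ : Type*} [DecidableEq Λ] {d : Λ → ℕ} {A B S : Finset Λ}

theorem QState.renyiCorr_reduced_le (ω : QState d) (hSA : S ⊆ A) (hAB : A ⊆ B) (O : Op d S) :
    renyiCorr (ω.reduced B) (extend (hSA.trans hAB) O) ≤
      renyiCorr (ω.reduced A) (extend hSA O) := by
  rw [← extend_extend hSA hAB, ← ω.partialTrace_reduced hAB]
  exact renyiCorr_extend_le hAB (ω.isDensityMatrix_reduced B).posSemidef _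

theorem QState.fidelityCorr_reduced_le (ω : QState d) (hSA : S ⊆ A) (hAB : A ⊆ B) (O : Op d S) :
    fidelityCorr (ω.reduced B) (extend (hSA.trans hAB) O) ≤
      fidelityCorr (ω.reduced A) (extend hSA O) := by
  rw [← extend_extend hSA hAB, ← ω.partialTrace_reduced hAB]
  exact fidelityCorr_extend_le hAB (ω.isDensityMatrix_reduced B).posSemidef _

theorem QState.fid_nonneg (ω : QState d) (O : Op d S) (A : Finset Λ) : 0 ≤ ω.fid O A := by
  rw [QState.fid]
  split_ifs
  · exact fidelityCorr_nonneg _ _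
  · exact le_rfl

/-- The common default value `0` keeps the inequality valid at every region, so it passes to the
limit without restriction. -/
theorem QState.fid_sq_le_renyi (ω : QState d) (O : Op d S) (A : Finset Λ) :
    ω.fid O A ^ 2 ≤ ω.renyi O A := by
  rw [QState.fid, QState.renyi]
  split_ifs with h
  · exact ((ω.isDensityMatrix_reduced A).correlator_bounds h O).1
  · simp

theorem QState.renyi_le_mul_fid (ω : QState d) (O : Op d S) (A : Finset Λ) :
    ω.renyi O A ≤ opNorm O * ω.fid O A := by
  rw [QState.fid, QState.renyi]
  split_ifs with h
  · exact ((ω.isDensityMatrix_reduced A).correlator_bounds h O).2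
  · simp

/-- The limits are taken over the net of all regions, before any centre or covering is chosen, which
makes them independent of both. -/
theorem QState.exists_tendsto_correlators (ω : QState d) (O : Op d S) :
    ∃ R F : ℝ, Tendsto (ω.renyi O) atTop (nhds R) ∧ Tendsto (ω.fid O) atTop (nhds F) ∧
      F ^ 2 ≤ R ∧ R ≤ opNorm O * F ∧ (0 < R ↔ 0 < F) := by
  obtain ⟨R, hR⟩ := exists_tendsto_of_antitone S (f := ω.renyi O)
    (fun A _ => (sq_nonneg _).trans (ω.fid_sq_le_renyi O A)) fun A B hA hAB => by
      simpa only [QState.renyi, dif_pos hA, dif_pos (hA.trans hAB)] using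
        ω.renyiCorr_reduced_le hA hAB O
  obtain ⟨F, hF⟩ := exists_tendsto_of_antitone S (f := ω.fid O)
    (fun A _ => ω.fid_nonneg O A) fun A B hA hAB => by
      simpa only [QState.fid, dif_pos hA, dif_pos (hA.trans hAB)] using
        ω.fidelityCorr_reduced_le hA hAB O
  have h0 : 0 ≤ F := ge_of_tendsto' hF (ω.fid_nonneg O)
  have h1 : F ^ 2 ≤ R := le_of_tendsto_of_tendsto' (hF.pow 2) hR (ω.fid_sq_le_renyi O)
  have h2 : R ≤ opNorm O * F :=
    le_of_tendsto_of_tendsto' hR (hF.const_mul _) (ω.renyi_le_mul_fid O)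
  refine ⟨R, F, hR, hF, h1, h2, fun h => ?_, fun h => (pow_pos h 2).trans_le h1⟩
  exact pos_of_mul_pos_right (h.trans_le h2) (opNorm_nonneg O)

end States

end LatticeSystem

theorem mainTheorem9 {Λ : Type*} [MetricSpace Λ] [DecidableEq Λ] (d : Λ → ℕ)
    (S : Finset Λ) (O : LatticeSystem.Op d S) :
    -- mixed states of a finite system on the set of sites `Ω`
    (∀ (Ω : Finset Λ) (ρ : LatticeSystem.Op d Ω), LatticeSystem.IsDensityMatrix ρ →
      (∀ (A B : Finset Λ) (hSA : S ⊆ A) (hAB : A ⊆ B) (hB : B ⊆ Ω),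
        LatticeSystem.renyiCorr (LatticeSystem.partialTrace hB ρ)
            (LatticeSystem.extend (hSA.trans hAB) O) ≤
          LatticeSystem.renyiCorr (LatticeSystem.partialTrace (hAB.trans hB) ρ)
            (LatticeSystem.extend hSA O)) ∧
      (∀ (A : Finset Λ) (hSA : S ⊆ A) (hA : A ⊆ Ω),
        LatticeSystem.fidelityCorr (LatticeSystem.partialTrace hA ρ)
            (LatticeSystem.extend hSA O) ^ 2 ≤
          LatticeSystem.renyiCorr (LatticeSystem.partialTrace hA ρ)
            (LatticeSystem.extend hSA O) ∧
        LatticeSystem.renyiCorr (LatticeSystem.partialTrace hA ρ)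
            (LatticeSystem.extend hSA O) ≤
          LatticeSystem.opNorm O *
            LatticeSystem.fidelityCorr (LatticeSystem.partialTrace hA ρ)
              (LatticeSystem.extend hSA O))) ∧
    -- states of the (possibly infinite) lattice
    (∀ ω : LatticeSystem.QState d,
      (∀ (A B : Finset Λ) (hSA : S ⊆ A) (hAB : A ⊆ B),
        LatticeSystem.renyiCorr (ω.reduced B) (LatticeSystem.extend (hSA.trans hAB) O) ≤
          LatticeSystem.renyiCorr (ω.reduced A) (LatticeSystem.extend hSA O)) ∧
      (∀ (A : Finset Λ) (hSA : S ⊆ A),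
        LatticeSystem.fidelityCorr (ω.reduced A) (LatticeSystem.extend hSA O) ^ 2 ≤
          LatticeSystem.renyiCorr (ω.reduced A) (LatticeSystem.extend hSA O) ∧
        LatticeSystem.renyiCorr (ω.reduced A) (LatticeSystem.extend hSA O) ≤
          LatticeSystem.opNorm O *
            LatticeSystem.fidelityCorr (ω.reduced A) (LatticeSystem.extend hSA O)) ∧
      (∀ x : Λ, ∃ R F : ℝ,
        LatticeSystem.IsCoveringLimit x (ω.renyi O) R ∧
        LatticeSystem.IsCoveringLimit x (ω.fid O) F ∧
        F ^ 2 ≤ R ∧ R ≤ LatticeSystem.opNorm O * F ∧ (0 < R ↔ 0 < F))) := by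
  refine ⟨fun Ω ρ hρ => ⟨fun A B hSA hAB hB => ?_, fun A hSA hA =>
    (hρ.partialTrace hA).correlator_bounds hSA O⟩, fun ω => ⟨fun A B hSA hAB =>
    ω.renyiCorr_reduced_le hSA hAB O, fun A hSA =>
    (ω.isDensityMatrix_reduced A).correlator_bounds hSA O, fun x => ?_⟩⟩
  · rw [← LatticeSystem.extend_extend hSA hAB, ← LatticeSystem.partialTrace_partialTrace hAB hB]
    exact LatticeSystem.renyiCorr_extend_le hAB (hρ.partialTrace hB).posSemidef _
  · obtain ⟨R, F, hR, hF, h⟩ := ω.exists_tendsto_correlators O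
    exact ⟨R, F, fun A hA => hR.comp hA.tendsto_atTop, fun A hA => hF.comp hA.tendsto_atTop, h⟩
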